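/- Let $A$ be a complete Noetherian local ring with finite residue field and maximal ideal $\mathfrak m_A$, equipped with its $\mathfrak m_A$-adic topology, and let $G$ be a locally profinite group (for example the group of rational points of a connected reductive group over a finite extension of $\mathbb Q_p$). An $A$-module $U$ is \emph{orthonormalizable} if it is $\mathfrak m_A$-adically complete and separated and $U/\mathfrak m_A^nU$ is free over $A/\mathfrak m_A^n$ for all $n$. An \emph{$\mathfrak m_A$-adically continuous} $A[G]$-module is an $\mathfrak m_A$-adically complete and separated $A$-module $\pi$ with an $A$-linear $G$-action such that $G\times\pi\to\pi$ is continuous for the $\mathfrak m_A$-adic topology on $\pi$. Let $\mathrm{Mod}_G^{\mathfrak m_A\text{-cont}}(A)^{\mathrm{fl}}$ be the category of orthonormalizable $\mathfrak m_A$-adically continuous $A[G]$-modules, with $A[G]$-linear maps. A \emph{profinite augmented representation} of $G$ over $A$ is a profinite linearly topologized $A$-module $M$ with an action of $G$ by continuous $A$-linear maps such that, for some compact open subgroup $K\subset G$, the $K$-action extends to a structure of topological module over $A[[K]]=\varprojlim_{K'}A[K/K']$ ($K'$ running over the open normal subgroups of $K$). It is \emph{topologically free} if $M\cong A^I$ as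 topological $A$-modules for some set $I$. Let $\mathrm{Mod}_G^{\mathrm{pro\,aug}}(A)^{\mathrm{fl}}$ be the category of topologically free profinite augmented representations, with continuous $A[G]$-linear maps. Then: (1) $\pi\mapsto\pi^\vee:=\mathrm{Hom}_A(\pi,A)$ (with the topology of pointwise convergence and the contragredient $G$-action) and $M\mapsto M^\vee:=\mathrm{Hom}_A^{\mathrm{cont}}(M,A)$ (with the contragredient $G$-action) define contravariant functors between $\mathrm{Mod}_G^{\mathfrak m_A\text{-cont}}(A)^{\mathrm{fl}}$ and $\mathrm{Mod}_G^{\mathrm{pro\,aug}}(A)^{\mathrm{fl}}$, which are anti-equivalences of categories, quasi-inverse to each other through the evaluation maps $\pi\to\pi^{\vee\vee}$ and $M\to M^{\vee\vee}$. (2) This anti-equivalence is compatible with base change: let $A\to A'$ be a local homomorphism to another complete Noetherian local ring with finite residue field, and put $\pi\mathbin{\widehat\otimes}_AA':=\varprojlim_n\pi\otimes_AA'/\mathfrak m_{A'}^n$ and $M\mathbin{\widehat\otimes}_AA':=\varprojlim_{N,\mathfrak a}M/N\otimes_AA'/\mathfrak a$, where $N\subset M$ runs over the open $A$-submodules and $\mathfrak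 a\subset A'$ over the open ideals. These functors take $\mathrm{Mod}_G^{\mathfrak m_A\text{-cont}}(A)^{\mathrm{fl}}$ to $\mathrm{Mod}_G^{\mathfrak m_{A'}\text{-cont}}(A')^{\mathrm{fl}}$ and $\mathrm{Mod}_G^{\mathrm{pro\,aug}}(A)^{\mathrm{fl}}$ to $\mathrm{Mod}_G^{\mathrm{pro\,aug}}(A')^{\mathrm{fl}}$, and for $\pi$ in $\mathrm{Mod}_G^{\mathfrak m_A\text{-cont}}(A)^{\mathrm{fl}}$ there is an isomorphism of topological $A'$-modules with $G$-action, natural in $\pi$, $$\mathrm{Hom}_A(\pi,A)\mathbin{\widehat\otimes}_AA'\;\cong\;\mathrm{Hom}_{A'}(\pi\mathbin{\widehat\otimes}_AA',A'),$$ which sends $f\otimes a$ to a linear form with $x\otimes b\mapsto ab\,f(x)$. -/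

import Mathlib

open CategoryTheory IsLocalRing TensorProduct Topology

universe u v w

noncomputable section

/-! ### Coefficient rings -/

/-- A complete Noetherian local ring with finite residue field, carrying its `𝔪`-adic topology. -/
class IsCompleteNoetherianLocal (A : Type u) [CommRing A] [TopologicalSpace A] : Prop
    extends IsTopologicalRing A, IsLocalRing A, IsNoetherianRing A where
  isAdicComplete : IsAdicComplete (maximalIdeal A) A
  finite_residueField : Finite (ResidueField A)
  isAdic : IsAdic (maximalIdeal A)

/-! ### Modules with the `𝔪`-adic topology -/

section AdicModules

variable (A : Type u) [CommRing A] [IsLocalRing A]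

/-- An `A`-module `U` is orthonormalizable if it is `𝔪`-adically complete and separated and each
`U / 𝔪ⁿ U` is free over `A / 𝔪ⁿ`. -/
def IsOrthonormalizable (U : Type v) [AddCommGroup U] [Module A U] : Prop :=
  IsAdicComplete (maximalIdeal A) U ∧
    ∀ n : ℕ, Module.Free (A ⧸ (maximalIdeal A) ^ n)
      (U ⧸ ((maximalIdeal A) ^ n • (⊤ : Submodule A U)))

variable {A} {G : Type w} [Group G] [TopologicalSpace G]

/-- An `A[G]`-module is `𝔪`-adically continuous if it is `𝔪`-adically complete and separated and
the action map `G × π → π` is continuous for the `𝔪`-adic topology on `π`. -/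
def IsAdicallyContinuous (π : Rep.{v} A G) : Prop :=
  IsAdicComplete (maximalIdeal A) π ∧
    letI : TopologicalSpace π := (maximalIdeal A).adicModuleTopology π
    Continuous fun p : G × π => π.ρ p.1 p.2

variable (A G)

/-- The orthonormalizable `𝔪`-adically continuous `A[G]`-modules, as a full subcategory of the
category of all `A[G]`-modules. -/
def contFl : ObjectProperty (Rep.{v} A G) := fun π =>
  IsAdicallyContinuous π ∧ IsOrthonormalizable A π

end AdicModules

/-! ### Completed group algebras and profinite augmented representations -/

section CompletedGroupAlgebra

variable (A : Type u) [CommRing A] (K : Type w) [Group K] [TopologicalSpace K]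

/-- The map `A[K/U] → A[K/V]` for open normal subgroups `U ≤ V`. -/
def groupAlgebraTransition {U V : OpenNormalSubgroup K} (h : U ≤ V) :
    MonoidAlgebra A (K ⧸ U.toSubgroup) →+* MonoidAlgebra A (K ⧸ V.toSubgroup) :=
  MonoidAlgebra.mapDomainRingHom A
    (QuotientGroup.map U.toSubgroup V.toSubgroup (MonoidHom.id K) h)

/-- The completed group algebra `A[[K]] = lim A[K/U]`, the limit being over the open normal
subgroups `U` of `K`, as a ring of compatible families. -/
def completedGroupAlgebraSubring :
    Subring (∀ U : OpenNormalSubgroup K, MonoidAlgebra A (K ⧸ U.toSubgroup)) where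
  carrier := {x | ∀ (U V : OpenNormalSubgroup K) (h : U ≤ V),
    groupAlgebraTransition A K h (x U) = x V}
  mul_mem' hx hy U V h := by simp [hx U V h, hy U V h]
  one_mem' U V h := by simp
  add_mem' hx hy U V h := by simp [hx U V h, hy U V h]
  zero_mem' U V h := by simp
  neg_mem' hx U V h := by simp [hx U V h]

/-- The completed group algebra `A[[K]]`. -/
abbrev CompletedGroupAlgebra : Type (max u w) := completedGroupAlgebraSubring A K

/-- The limit topology on `A[[K]]`, each `A[K/U]` having the product topology of its
coefficients. -/
instance [TopologicalSpace A] : TopologicalSpace (CompletedGroupAlgebra A K) :=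
  TopologicalSpace.induced
    (fun x (U : OpenNormalSubgroup K) (q : K ⧸ U.toSubgroup) => (x.1 U).coeff q) inferInstance

/-- The canonical map `A[K] → A[[K]]`. -/
def toCompletedGroupAlgebra : MonoidAlgebra A K →+* CompletedGroupAlgebra A K :=
  (RingHom.pi fun U : OpenNormalSubgroup K =>
    MonoidAlgebra.mapDomainRingHom A (QuotientGroup.mk' U.toSubgroup)).codRestrict _ (by
      intro x U V h
      exact congrArg (fun f : MonoidAlgebra A K →+* MonoidAlgebra A (K ⧸ V.toSubgroup) => f x)
        (MonoidAlgebra.mapDomainRingHom_comp (R := A)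
          (QuotientGroup.map U.toSubgroup V.toSubgroup (MonoidHom.id K) h)
          (QuotientGroup.mk' U.toSubgroup)).symm)

end CompletedGroupAlgebra

section Augmented

variable {A : Type u} [CommRing A] [TopologicalSpace A]
  {G : Type w} [Group G] [TopologicalSpace G]

/-- A profinite (linear-topological) `A`-module. -/
structure IsProfiniteModule (A : Type u) [CommRing A] (M : Type v) [AddCommGroup M]
    [Module A M] [TopologicalSpace M] : Prop where
  compactSpace : CompactSpace M
  t2Space : T2Space M
  totallyDisconnectedSpace : TotallyDisconnectedSpace M
  isLinearTopology : IsLinearTopology A M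

/-- `M` is topologically free if it is isomorphic, as a topological `A`-module, to a direct product
of copies of `A`. -/
def IsTopologicallyFree (A : Type u) [CommRing A] [TopologicalSpace A] (M : Type v)
    [AddCommGroup M] [Module A M] [TopologicalSpace M] : Prop :=
  ∃ I : Type v, Nonempty (M ≃L[A] (I → A))

/-- For some compact open subgroup `K` of `G`, the action of `K` on `M` extends to a structure of
topological `A[[K]]`-module on `M`. -/
def IsAugmented (M : TopRep.{v} A G) : Prop :=
  ∃ K : Subgroup G, IsOpen (K : Set G) ∧ IsCompact (K : Set G) ∧
    ∃ _ : Module (CompletedGroupAlgebra A K) M,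
      (∀ (x : MonoidAlgebra A K) (m : M), toCompletedGroupAlgebra A K x • m =
        Representation.asAlgebraHom (M.ρ.toRepresentation.comp K.subtype) x m) ∧
      Continuous fun p : CompletedGroupAlgebra A K × M => p.1 • p.2

/-- A profinite augmented representation of `G` over `A`. -/
def IsProfiniteAugmented (M : TopRep.{v} A G) : Prop :=
  IsProfiniteModule A M ∧ IsAugmented M

variable (A G)

/-- The topologically free profinite augmented `G`-representations over `A`, as a full subcategory
of the category of topological `A`-modules on which `G` acts by continuous `A`-linear maps; the
morphisms are the continuous `A[G]`-linear maps. -/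
def proAugFl : ObjectProperty (TopRep.{v} A G) := fun M =>
  IsProfiniteAugmented M ∧ IsTopologicallyFree A M

end Augmented

/-! ### The duality functors -/

section Duality

variable (A : Type u) [CommRing A]

/-- `Hom_A(U, A)`, to be given the topology of pointwise convergence. -/
def PointwiseDual (U : Type v) [AddCommGroup U] [Module A U] : Type (max u v) :=
  Module.Dual A U

namespace PointwiseDual

section
variable (U : Type v) [AddCommGroup U] [Module A U]

instance : AddCommGroup (PointwiseDual A U) := inferInstanceAs (AddCommGroup (Module.Dual A U))
instance : Module A (PointwiseDual A U) := inferInstanceAs (Module A (Module.Dual A U))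
instance : FunLike (PointwiseDual A U) U A := inferInstanceAs (FunLike (Module.Dual A U) U A)

/-- The inclusion of `Hom_A(U, A)` in the module of all functions `U → A`. -/
def incl : PointwiseDual A U →ₗ[A] (U → A) where
  toFun f x := f x
  map_add' _ _ := rfl
  map_smul' _ _ := rfl

variable [TopologicalSpace A]

/-- The topology of pointwise convergence. -/
instance : TopologicalSpace (PointwiseDual A U) :=
  TopologicalSpace.induced (incl A U) inferInstance

instance [IsTopologicalRing A] : IsTopologicalAddGroup (PointwiseDual A U) :=
  topologicalAddGroup_induced (incl A U)

instance [IsTopologicalRing A] : ContinuousSMul A (PointwiseDual A U) :=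
  continuousSMul_induced (incl A U)

end

variable {A}
variable {U : Type v} [AddCommGroup U] [Module A U]

@[ext] theorem ext {f g : PointwiseDual A U} (h : ∀ x, f x = g x) : f = g :=
  DFunLike.ext _ _ h

variable [TopologicalSpace A]

theorem continuous_eval (x : U) : Continuous fun f : PointwiseDual A U => f x :=
  (continuous_apply x).comp continuous_induced_dom

/-- The transpose `f ↦ f ∘ φ` of a linear map `φ`. -/
def map {U' : Type v} [AddCommGroup U'] [Module A U'] (φ : U →ₗ[A] U') :
    PointwiseDual A U' →L[A] PointwiseDual A U where
  toFun f := LinearMap.comp (M₃ := A) f φ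
  map_add' _ _ := rfl
  map_smul' _ _ := rfl
  cont := continuous_induced_rng.2 (continuous_pi fun x => continuous_eval (φ x))

@[simp] theorem map_apply {U' : Type v} [AddCommGroup U'] [Module A U'] (φ : U →ₗ[A] U')
    (f : PointwiseDual A U') (x : U) : map φ f x = f (φ x) := rfl

end PointwiseDual

variable [TopologicalSpace A] [IsTopologicalRing A] (G : Type w) [Group G]

/-- The contragredient action `(g f)(x) = f(g⁻¹ x)` on `Hom_A(π, A)`. -/
def contragredient (π : Rep.{v} A G) : ContRepresentation A G (PointwiseDual A π) :=
  .ofMonoidHom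
    { toFun := fun g => PointwiseDual.map (π.ρ g⁻¹)
      map_one' := by ext f x; simp
      map_mul' := fun g h => by ext f x; simp }

@[simp] theorem contragredient_apply (π : Rep.{v} A G) (g : G) (f : PointwiseDual A π) (x : π) :
    contragredient A G π g f x = f (π.ρ g⁻¹ x) := rfl

/-- The functor `π ↦ π^∨ = Hom_A(π, A)` (topology of pointwise convergence, contragredient
`G`-action). -/
def dualFunctor : (Rep.{u} A G)ᵒᵖ ⥤ TopRep.{u} A G where
  obj π := TopRep.of (contragredient A G π.unop)
  map φ := TopRep.ofHom
    { PointwiseDual.map φ.unop.hom.toLinearMap with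
      isIntertwining' := fun g => by
        ext f x
        exact congrArg f (Rep.hom_comm_apply φ.unop g⁻¹ x).symm }
  map_id _ := rfl
  map_comp _ _ := rfl

/-- The contragredient action `(g f)(m) = f(g⁻¹ m)` on `Hom_A^cont(M, A)`. -/
def contContragredient (M : TopRep.{v} A G) : Representation A G (M →L[A] A) where
  toFun g :=
    { toFun := fun f => f.comp (M.ρ g⁻¹)
      map_add' := fun _ _ => rfl
      map_smul' := fun _ _ => rfl }
  map_one' := by ext f m; simp
  map_mul' g h := by ext f m; simp only [mul_inv_rev, map_mul]; rfl

@[simp] theorem contContragredient_apply (M : TopRep.{v} A G) (g : G) (f : M →L[A] A) (m : M) :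
    contContragredient A G M g f m = f (M.ρ g⁻¹ m) := rfl

/-- The functor `M ↦ M^∨ = Hom_A^cont(M, A)` (contragredient `G`-action). -/
def contDualFunctor : (TopRep.{u} A G)ᵒᵖ ⥤ Rep.{u} A G where
  obj M := Rep.of (contContragredient A G M.unop)
  map φ := Rep.ofHom
    { toFun := fun f => f.comp φ.unop.hom.toContinuousLinearMap
      map_add' := fun _ _ => rfl
      map_smul' := fun _ _ => rfl
      isIntertwining' := fun g => by
        ext f x
        exact congrArg f (TopRep.hom_comm_apply φ.unop g⁻¹ x).symm }
  map_id _ := rfl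
  map_comp _ _ := rfl

/-- The evaluation map `π → Hom_A^cont(Hom_A(π, A), A)`, `x ↦ (f ↦ f x)`. -/
def evalRep (π : Rep.{u} A G) :
    π ⟶ (contDualFunctor A G).obj (.op ((dualFunctor A G).obj (.op π))) :=
  Rep.ofHom (ρ := π.ρ)
    (σ := contContragredient A G (TopRep.of (contragredient A G π)))
    { toFun := fun x =>
        { toFun := fun f : PointwiseDual A π => f x
          map_add' := fun _ _ => rfl
          map_smul' := fun _ _ => rfl
          cont := PointwiseDual.continuous_eval x }
      map_add' := fun x y => by
        ext f; exact map_add (show Module.Dual A π from f) x y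
      map_smul' := fun a x => by
        ext f; exact map_smul (show Module.Dual A π from f) a x
      isIntertwining' := fun g => by
        ext x f
        change f (π.ρ g x) = f (π.ρ g⁻¹⁻¹ x)
        rw [inv_inv] }

/-- The evaluation map `M → Hom_A(Hom_A^cont(M, A), A)`, `m ↦ (f ↦ f m)`. -/
def evalTopRep (M : TopRep.{u} A G) :
    M ⟶ (dualFunctor A G).obj (.op ((contDualFunctor A G).obj (.op M))) :=
  TopRep.ofHom (ρ := M.ρ)
    (σ := contragredient A G (Rep.of (contContragredient A G M)))
    { toFun := fun m => show Module.Dual A (M →L[A] A) from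
        { toFun := fun f => f m
          map_add' := fun _ _ => rfl
          map_smul' := fun _ _ => rfl }
      map_add' := fun x y => PointwiseDual.ext fun f => map_add f x y
      map_smul' := fun a x => PointwiseDual.ext fun f => map_smul f a x
      cont := continuous_induced_rng.2 (continuous_pi fun f => ContinuousLinearMap.continuous f)
      isIntertwining' := fun g => by
        refine ContinuousLinearMap.ext fun m =>
          PointwiseDual.ext (A := A) (U := M →L[A] A) fun f => ?_
        change f (M.ρ g m) = f (M.ρ g⁻¹⁻¹ m)
        rw [inv_inv] }

end Duality

/-! ### Base change -/

section QuotTensor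

variable {A : Type u} [CommRing A] {A' : Type u} [CommRing A'] [Algebra A A']
variable {U U' U'' : Type v} [AddCommGroup U] [Module A U] [AddCommGroup U'] [Module A U']
  [AddCommGroup U''] [Module A U'']

/-- The map `A'/I ⊗_A U → A'/J ⊗_A U'` induced by an inclusion `I ≤ J` and a linear map `φ`. -/
def quotTensorMap {I J : Ideal A'} (h : I ≤ J) (φ : U →ₗ[A] U') :
    (A' ⧸ I) ⊗[A] U →ₗ[A'] (A' ⧸ J) ⊗[A] U' :=
  AlgebraTensorModule.map (Submodule.factor h : (A' ⧸ I) →ₗ[A'] (A' ⧸ J)) φ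

theorem quotTensorMap_comp {I J L : Ideal A'} (h : I ≤ J) (h' : J ≤ L) (ψ : U' →ₗ[A] U'')
    (φ : U →ₗ[A] U') (x : (A' ⧸ I) ⊗[A] U) :
    quotTensorMap h' ψ (quotTensorMap h φ x) = quotTensorMap (h.trans h') (ψ ∘ₗ φ) x := by
  induction x using TensorProduct.induction_on with
  | zero => simp
  | add x y hx hy => rw [map_add, map_add, map_add, hx, hy]
  | tmul b m =>
    obtain ⟨b, rfl⟩ := Ideal.Quotient.mk_surjective b
    rfl

theorem quotTensorMap_id {I : Ideal A'} (x : (A' ⧸ I) ⊗[A] U) :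
    quotTensorMap (le_refl I) (LinearMap.id : U →ₗ[A] U) x = x := by
  induction x using TensorProduct.induction_on with
  | zero => simp
  | add x y hx hy => rw [map_add, hx, hy]
  | tmul b m =>
    obtain ⟨b, rfl⟩ := Ideal.Quotient.mk_surjective b
    rfl

end QuotTensor

section AdicBaseChange

variable (A : Type u) [CommRing A] (A' : Type u) [CommRing A'] [IsLocalRing A'] [Algebra A A']

/-- The map `A'/𝔪'ⁿ ⊗_A U → A'/𝔪'ᵐ ⊗_A U` for `m ≤ n`. -/
def adicTransition (U : Type v) [AddCommGroup U] [Module A U] {m n : ℕ} (h : m ≤ n) :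
    (A' ⧸ maximalIdeal A' ^ n) ⊗[A] U →ₗ[A'] (A' ⧸ maximalIdeal A' ^ m) ⊗[A] U :=
  quotTensorMap (Ideal.pow_le_pow_right h) LinearMap.id

/-- The completed tensor product `lim_n U ⊗_A A'/𝔪'ⁿ`, as a module of compatible families. -/
def adicBaseChange (U : Type v) [AddCommGroup U] [Module A U] :
    Submodule A' (∀ n : ℕ, (A' ⧸ maximalIdeal A' ^ n) ⊗[A] U) where
  carrier := {x | ∀ (m n : ℕ) (h : m ≤ n), adicTransition A A' U h (x n) = x m}
  add_mem' hx hy m n h := by simp [hx m n h, hy m n h]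
  zero_mem' m n h := by simp
  smul_mem' a x hx m n h := by simp [hx m n h]

variable {A}

/-- The map of completed tensor products induced by a linear map. -/
def adicBaseChangeMap {U U' : Type v} [AddCommGroup U] [Module A U] [AddCommGroup U']
    [Module A U'] (φ : U →ₗ[A] U') : adicBaseChange A A' U →ₗ[A'] adicBaseChange A A' U' where
  toFun x := ⟨fun n => quotTensorMap (le_refl _) φ (x.1 n), fun m n h => by
    have := x.2 m n h
    beta_reduce
    rw [← this, adicTransition, adicTransition, quotTensorMap_comp, quotTensorMap_comp,
      LinearMap.id_comp, LinearMap.comp_id]⟩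
  map_add' x y := Subtype.ext <| funext fun n => by simp
  map_smul' a x := Subtype.ext <| funext fun n => by simp

theorem adicBaseChangeMap_id (U : Type v) [AddCommGroup U] [Module A U] :
    adicBaseChangeMap A' (LinearMap.id : U →ₗ[A] U) = LinearMap.id :=
  LinearMap.ext fun x => Subtype.ext <| funext fun n => quotTensorMap_id (x.1 n)

theorem adicBaseChangeMap_comp {U U' U'' : Type v} [AddCommGroup U] [Module A U]
    [AddCommGroup U'] [Module A U'] [AddCommGroup U''] [Module A U'']
    (ψ : U' →ₗ[A] U'') (φ : U →ₗ[A] U') :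
    adicBaseChangeMap A' (ψ ∘ₗ φ) = adicBaseChangeMap A' ψ ∘ₗ adicBaseChangeMap A' φ :=
  LinearMap.ext fun x => Subtype.ext <| funext fun n =>
    (quotTensorMap_comp le_rfl le_rfl ψ φ (x.1 n)).symm

/-- The base change functor `π ↦ π ⊗̂_A A'` on `A[G]`-modules, `G` acting through `π`. -/
def adicBaseChangeFunctor (G : Type w) [Group G] : Rep.{u} A G ⥤ Rep.{u} A' G where
  obj π := Rep.of (X := adicBaseChange A A' π)
    { toFun := fun g => adicBaseChangeMap A' (π.ρ g)
      map_one' := by rw [map_one]; exact adicBaseChangeMap_id A' π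
      map_mul' := fun g h => by rw [map_mul]; exact adicBaseChangeMap_comp A' _ _ }
  map φ := Rep.ofHom
    { adicBaseChangeMap A' φ.hom.toLinearMap with
      isIntertwining' := fun g => by
        refine (adicBaseChangeMap_comp A' _ _).symm.trans
          (Eq.trans ?_ (adicBaseChangeMap_comp A' _ _))
        rw [φ.hom.isIntertwining'] }
  map_id π := Rep.hom_ext (Representation.IntertwiningMap.ext (adicBaseChangeMap_id A' π))
  map_comp φ ψ := Rep.hom_ext (Representation.IntertwiningMap.ext
    (adicBaseChangeMap_comp A' ψ.hom.toLinearMap φ.hom.toLinearMap))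

/-- The element `x ⊗ b` of `π ⊗̂_A A'`. -/
def adicTmul {G : Type w} [Group G] (π : Rep.{u} A G) (x : π) (b : A') :
    (adicBaseChangeFunctor A' G).obj π :=
  show adicBaseChange A A' π from ⟨fun _ => Ideal.Quotient.mk _ b ⊗ₜ x, fun _ _ _ => rfl⟩

end AdicBaseChange

section ProBaseChange

variable (A : Type u) [CommRing A] (A' : Type u) [CommRing A'] [Algebra A A']

/-- The map `M/N ⊗_A A'/𝔞 → M/N' ⊗_A A'/𝔞'` for `N ≤ N'` and `𝔞 ≤ 𝔞'`. -/
def proTransition (M : Type v) [AddCommGroup M] [Module A M] {N N' : Submodule A M}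
    {𝔞 𝔞' : Ideal A'} (hN : N ≤ N') (h𝔞 : 𝔞 ≤ 𝔞') :
    (A' ⧸ 𝔞) ⊗[A] (M ⧸ N) →ₗ[A'] (A' ⧸ 𝔞') ⊗[A] (M ⧸ N') :=
  quotTensorMap h𝔞 (Submodule.factor hN)

theorem smul_eq_zero_of_mem_ideal (M : Type v) [AddCommGroup M] [Module A M] {N : Submodule A M} {𝔞 : Ideal A'} {a : A'} (ha : a ∈ 𝔞)
    (x : (A' ⧸ 𝔞) ⊗[A] (M ⧸ N)) : a • x = 0 := by
  induction x using TensorProduct.induction_on with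
  | zero => simp
  | add x y hx hy => rw [smul_add, hx, hy, add_zero]
  | tmul b m =>
    obtain ⟨b, rfl⟩ := Ideal.Quotient.mk_surjective b
    rw [TensorProduct.smul_tmul']
    have : a • (Ideal.Quotient.mk 𝔞 b) = 0 :=
      (Ideal.Quotient.eq_zero_iff_mem (I := 𝔞) (a := a * b)).2 (𝔞.mul_mem_right b ha)
    rw [this, TensorProduct.zero_tmul]

variable [TopologicalSpace A']

/-- Pairs `(N, 𝔞)` of an open `A`-submodule of `M` and an open ideal of `A'`. -/
abbrev OpenPair (M : Type v) [AddCommGroup M] [Module A M] [TopologicalSpace M] : Type (max u v) :=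
  {N : Submodule A M // IsOpen (N : Set M)} × {𝔞 : Ideal A' // IsOpen (𝔞 : Set A')}

/-- The completed tensor product `lim M/N ⊗_A A'/𝔞`, the limit being over the open `A`-submodules
`N` of `M` and the open ideals `𝔞` of `A'`, as a module of compatible families. -/
def proBaseChange (M : Type v) [AddCommGroup M] [Module A M] [TopologicalSpace M] :
    Submodule A' (∀ p : OpenPair A A' M, (A' ⧸ p.2.1) ⊗[A] (M ⧸ p.1.1)) where
  carrier := {x | ∀ (p q : OpenPair A A' M) (h₁ : p.1.1 ≤ q.1.1) (h₂ : p.2.1 ≤ q.2.1),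
    proTransition A A' M h₁ h₂ (x p) = x q}
  add_mem' hx hy p q h₁ h₂ := by simp [hx p q h₁ h₂, hy p q h₁ h₂]
  zero_mem' p q h₁ h₂ := by simp
  smul_mem' a x hx p q h₁ h₂ := by simp [hx p q h₁ h₂]

section
variable (M : Type v) [AddCommGroup M] [Module A M] [TopologicalSpace M]

/-- The projection to `M/N ⊗_A A'/𝔞`. -/
def proBaseChangeProj (p : OpenPair A A' M) :
    proBaseChange A A' M →ₗ[A'] (A' ⧸ p.2.1) ⊗[A] (M ⧸ p.1.1) :=
  LinearMap.proj p ∘ₗ (proBaseChange A A' M).subtype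

/-- The limit topology, each `M/N ⊗_A A'/𝔞` being discrete. -/
instance proBaseChangeTopology : TopologicalSpace (proBaseChange A A' M) :=
  ⨅ p : OpenPair A A' M, TopologicalSpace.induced (proBaseChangeProj A A' M p) ⊥

theorem continuous_proBaseChangeProj (p : OpenPair A A' M) :
    @Continuous _ _ _ ⊥ (proBaseChangeProj A A' M p) :=
  continuous_iff_le_induced.2 (iInf_le _ p)

instance : IsTopologicalAddGroup (proBaseChange A A' M) :=
  topologicalAddGroup_iInf fun p => by
    let : TopologicalSpace ((A' ⧸ p.2.1) ⊗[A] (M ⧸ p.1.1)) := ⊥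
    have : DiscreteTopology ((A' ⧸ p.2.1) ⊗[A] (M ⧸ p.1.1)) := ⟨rfl⟩
    exact topologicalAddGroup_induced (proBaseChangeProj A A' M p)

instance [IsTopologicalRing A'] : ContinuousSMul A' (proBaseChange A A' M) :=
  continuousSMul_iInf fun p => by
    let : TopologicalSpace ((A' ⧸ p.2.1) ⊗[A] (M ⧸ p.1.1)) := ⊥
    have : DiscreteTopology ((A' ⧸ p.2.1) ⊗[A] (M ⧸ p.1.1)) := ⟨rfl⟩
    have : ContinuousSMul A' ((A' ⧸ p.2.1) ⊗[A] (M ⧸ p.1.1)) := ⟨by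
      rw [continuous_iff_continuousAt]
      rintro ⟨a, x⟩
      refine tendsto_nhds_of_eventually_eq ?_
      have h1 : ∀ᶠ b in 𝓝 a, b - a ∈ p.2.1 := by
        have hc : Continuous fun b : A' => b - a := by fun_prop
        exact hc.continuousAt.preimage_mem_nhds (by simpa using p.2.2.mem_nhds p.2.1.zero_mem)
      have h2 : ∀ᶠ y in 𝓝 x, y = x := by simp
      rw [nhds_prod_eq]
      filter_upwards [h1.prod_mk h2] with q hq
      obtain ⟨hb, hy⟩ := hq
      have := smul_eq_zero_of_mem_ideal A A' M hb x
      change q.1 • q.2 = a • x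
      rw [hy, ← sub_add_cancel q.1 a]
      exact (add_smul (q.1 - a) a x).trans (by rw [this, zero_add])⟩
    exact continuousSMul_induced (proBaseChangeProj A A' M p)

end

variable {A}

/-- The inverse image of a pair `(N, 𝔞)` under a continuous linear map. -/
def OpenPair.comap [TopologicalSpace A] {M M' : Type v} [AddCommGroup M] [Module A M]
    [TopologicalSpace M] [AddCommGroup M'] [Module A M'] [TopologicalSpace M'] (φ : M →L[A] M')
    (p : OpenPair A A' M') : OpenPair A A' M :=
  (⟨p.1.1.comap φ.toLinearMap, p.1.2.preimage φ.continuous⟩, p.2)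

variable [TopologicalSpace A]

/-- The map `M/φ⁻¹(N) ⊗_A A'/𝔞 → M'/N ⊗_A A'/𝔞` induced by `φ`. -/
def proBaseChangeComponent {M M' : Type v} [AddCommGroup M] [Module A M]
    [TopologicalSpace M] [AddCommGroup M'] [Module A M'] [TopologicalSpace M'] (φ : M →L[A] M')
    (p : OpenPair A A' M') :
    (A' ⧸ (p.comap A' φ).2.1) ⊗[A] (M ⧸ (p.comap A' φ).1.1) →ₗ[A'] (A' ⧸ p.2.1) ⊗[A] (M' ⧸ p.1.1) :=
  quotTensorMap (le_refl p.2.1) (Submodule.mapQ (p.1.1.comap φ.toLinearMap) p.1.1 φ.toLinearMap le_rfl)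

/-- The continuous map of completed tensor products induced by a continuous linear map `φ`: its
component at `(N, 𝔞)` is induced by the map `M/φ⁻¹(N) → M'/N`. -/
def proBaseChangeMap {M M' : Type v} [AddCommGroup M] [Module A M]
    [TopologicalSpace M] [AddCommGroup M'] [Module A M'] [TopologicalSpace M'] (φ : M →L[A] M') :
    proBaseChange A A' M →L[A'] proBaseChange A A' M' where
  toFun x := ⟨fun p => proBaseChangeComponent A' φ p (x.1 (p.comap A' φ)), fun p q h₁ h₂ => by
    have := x.2 (p.comap A' φ) (q.comap A' φ) (Submodule.comap_mono h₁) h₂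
    beta_reduce
    rw [← this]
    refine (quotTensorMap_comp _ _ _ _ _).trans (Eq.trans ?_ (quotTensorMap_comp _ _ _ _ _).symm)
    congr 2
    ext m
    rfl⟩
  map_add' x y := Subtype.ext <| funext fun p => map_add (proBaseChangeComponent A' φ p) _ _
  map_smul' a x := Subtype.ext <| funext fun p => map_smul (proBaseChangeComponent A' φ p) a _
  cont := continuous_iInf_rng.2 fun p => continuous_induced_rng.2 <|
    @Continuous.comp _ _ _ _ ⊥ ⊥ _ (proBaseChangeComponent A' φ p) continuous_bot
      (continuous_proBaseChangeProj A A' M (p.comap A' φ))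

theorem proBaseChangeMap_id (M : Type v) [AddCommGroup M] [Module A M] [TopologicalSpace M] :
    proBaseChangeMap A' (ContinuousLinearMap.id A M) = ContinuousLinearMap.id A' _ :=
  ContinuousLinearMap.ext fun x => Subtype.ext <| funext fun p => by
    refine Eq.trans ?_ (quotTensorMap_id (x.1 p))
    change quotTensorMap (le_refl p.2.1) (Submodule.mapQ p.1.1 p.1.1 LinearMap.id le_rfl) (x.1 p) = _
    rw [Submodule.mapQ_id]

theorem proBaseChangeMap_comp {M M' M'' : Type v} [AddCommGroup M] [Module A M]
    [TopologicalSpace M] [AddCommGroup M'] [Module A M'] [TopologicalSpace M']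
    [AddCommGroup M''] [Module A M''] [TopologicalSpace M'']
    (ψ : M' →L[A] M'') (φ : M →L[A] M') :
    proBaseChangeMap A' (ψ ∘L φ) = proBaseChangeMap A' ψ ∘L proBaseChangeMap A' φ :=
  ContinuousLinearMap.ext fun x => Subtype.ext <| funext fun p => by
    refine Eq.trans ?_ (quotTensorMap_comp _ _ _ _ _).symm
    change quotTensorMap _ _ (x.1 ((p.comap A' ψ).comap A' φ)) = _
    congr 2
    ext m
    rfl

/-- The base change functor `M ↦ M ⊗̂_A A'` on topological `A`-modules with an action of `G`. -/
def proBaseChangeFunctor [IsTopologicalRing A'] (G : Type w) [Group G] :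
    TopRep.{u} A G ⥤ TopRep.{u} A' G where
  obj M := TopRep.of (X := proBaseChange A A' M) (.ofMonoidHom
    { toFun := fun g => proBaseChangeMap A' (M.ρ g)
      map_one' := by rw [map_one]; exact proBaseChangeMap_id A' M
      map_mul' := fun g h => by rw [map_mul]; exact proBaseChangeMap_comp A' _ _ })
  map φ := TopRep.ofHom
    { proBaseChangeMap A' φ.hom.toContinuousLinearMap with
      isIntertwining' := fun g => by
        refine (proBaseChangeMap_comp A' _ _).symm.trans
          (Eq.trans ?_ (proBaseChangeMap_comp A' _ _))
        rw [φ.hom.isIntertwining'] }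
  map_id M := TopRep.hom_ext (ContIntertwiningMap.ext (proBaseChangeMap_id A' M))
  map_comp φ ψ := TopRep.hom_ext (ContIntertwiningMap.ext
    (proBaseChangeMap_comp A' ψ.hom.toContinuousLinearMap φ.hom.toContinuousLinearMap))

/-- The element `m ⊗ b` of `M ⊗̂_A A'`. -/
def proTmul [IsTopologicalRing A'] {G : Type w} [Group G] (M : TopRep.{u} A G) (m : M) (b : A') :
    (proBaseChangeFunctor A' G).obj M :=
  show proBaseChange A A' M from
    ⟨fun _ => Ideal.Quotient.mk _ b ⊗ₜ Submodule.Quotient.mk m, fun _ _ _ _ => rfl⟩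

end ProBaseChange

/-- The value at `x ∈ π` of an element of the dual `π^∨ = Hom_A(π, A)`. -/
def dualApply {A : Type u} [CommRing A] [TopologicalSpace A] [IsTopologicalRing A]
    {G : Type w} [Group G] (π : Rep.{u} A G) (f : (dualFunctor A G).obj (.op π)) (x : π) : A :=
  (show PointwiseDual A π from f) x

/-! ### The induced functors on the full subcategories -/

section Restrict

variable (A : Type u) [CommRing A] [TopologicalSpace A] [IsTopologicalRing A] [IsLocalRing A]
  (G : Type w) [Group G] [TopologicalSpace G]

/-- The functor `π ↦ π^∨` from orthonormalizable `𝔪`-adically continuous modules to topologically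
free profinite augmented representations, given that it takes the former to the latter. -/
def dualFl (h : ∀ π : Rep.{u} A G, contFl A G π → proAugFl A G ((dualFunctor A G).obj (.op π))) :
    (contFl.{u} A G).FullSubcategoryᵒᵖ ⥤ (proAugFl.{u} A G).FullSubcategory :=
  (proAugFl A G).lift ((contFl A G).ι.op ⋙ dualFunctor A G)
    fun X => h X.unop.obj X.unop.property

/-- The functor `M ↦ M^∨` from topologically free profinite augmented representations to
orthonormalizable `𝔪`-adically continuous modules, given that it takes the former to the latter. -/
def contDualFl
    (h : ∀ M : TopRep.{u} A G, proAugFl A G M → contFl A G ((contDualFunctor A G).obj (.op M))) :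
    (proAugFl.{u} A G).FullSubcategoryᵒᵖ ⥤ (contFl.{u} A G).FullSubcategory :=
  (contFl A G).lift ((proAugFl A G).ι.op ⋙ contDualFunctor A G)
    fun X => h X.unop.obj X.unop.property

end Restrict

end

/-!
Lifting a basis of `U/𝔪U` gives an orthonormalizable module `U` an orthonormal basis `(eᵢ)`, so
that `U` is the `𝔪`-adic completion of a free module and restriction to `(eᵢ)` is a bijection
`Hom_A(U, A) → A^I`. It is continuous for the pointwise topology, hence a homeomorphism, both sides
being compact and Hausdorff. Conversely the coordinate functions are an orthonormal basis of
`Hom_A^cont(A^I, A)`, and both evaluation maps are bijective because they are so in coordinates.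

A compact open subgroup `K` acts through a finite quotient `K/V` on the quotients of `Hom_A(U, A)`
by a basis of open submodules `N`, which makes these quotients modules over `A[K/V]`; by compactness
of `Hom_A(U, A)` the limit over `N` is an action of `A[[K]]`. In the other direction, the action of
`A[[K]]` on `M` makes `G × M → M` continuous, and since `M` is compact, `f(g⁻¹m) - f(m)` tends to
`0` as `g → 1` uniformly in `m` for every continuous linear form `f`: this is the continuity of the
contragredient action.

An orthonormal basis of `U` stays one after base change, so `Hom_A(U, A) ⊗̂ A'` and
`Hom_{A'}(U ⊗̂ A', A')` are both identified with `A'^I`. Base change of profinite augmented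
representations is then reduced to the adic side by duality.
-/

noncomputable section

section Nilpotent

variable {R P Q : Type*} [CommRing R] [AddCommGroup P] [Module R P] [AddCommGroup Q] [Module R Q]

theorem eq_bot_of_le_smul_of_isNilpotent {N : Submodule R P} {𝔫 : Ideal R}
    (h𝔫 : IsNilpotent 𝔫) (hN : N ≤ 𝔫 • N) : N = ⊥ := by
  obtain ⟨k, hk⟩ := h𝔫
  have hpow (k : ℕ) : N ≤ 𝔫 ^ k • N := by
    induction k with
    | zero => simp
    | succ k ih =>
      rw [pow_succ, Submodule.mul_smul]
      exact ih.trans (Submodule.smul_mono le_rfl hN)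
  simpa [hk] using hpow k

theorem injective_of_ker_le_smul_top [Module.Projective R Q] {f : P →ₗ[R] Q}
    (hf : Function.Surjective f) {𝔫 : Ideal R} (h𝔫 : IsNilpotent 𝔫)
    (hker : LinearMap.ker f ≤ 𝔫 • ⊤) : Function.Injective f := by
  obtain ⟨s, hs⟩ := Module.projective_lifting_property f LinearMap.id hf
  let p : P →ₗ[R] P := LinearMap.id - s ∘ₗ f
  have hp : LinearMap.range p ≤ LinearMap.ker f := by
    rintro _ ⟨x, rfl⟩
    simpa [p, sub_eq_zero] using (LinearMap.congr_fun hs (f x)).symm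
  refine LinearMap.ker_eq_bot.1 (eq_bot_of_le_smul_of_isNilpotent h𝔫 fun x hx => ?_)
  have hpx : p x ∈ 𝔫 • LinearMap.range p := by
    rw [← Submodule.map_top, ← Submodule.map_smul'']
    exact Submodule.mem_map_of_mem (hker hx)
  have hpx' : p x = x := by simp [p, LinearMap.mem_ker.1 hx]
  exact hpx' ▸ Submodule.smul_mono le_rfl hp hpx

end Nilpotent

section OrthonormalBasis

variable {A : Type*} [CommRing A] {I U : Type*} [AddCommGroup U] [Module A U]

theorem mem_smul_top_finsupp_iff {J : Ideal A} {c : I →₀ A} :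
    c ∈ J • (⊤ : Submodule A (I →₀ A)) ↔ ∀ i, c i ∈ J := by
  rw [← (Finsupp.basisSingleOne (R := A) (ι := I)).span_eq,
    Submodule.mem_ideal_smul_span_iff_exists_sum]
  simp

theorem linearCombination_mk_mapRange (J : Ideal A) (e : I → U) (c : I →₀ A) :
    Finsupp.linearCombination (A ⧸ J)
        (fun i => (Submodule.Quotient.mk (e i) : U ⧸ (J • ⊤ : Submodule A U)))
        (c.mapRange (Ideal.Quotient.mk J) (map_zero _)) =
      Submodule.Quotient.mk (Finsupp.linearCombination A e c) := by
  induction c using Finsupp.induction_linear with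
  | zero => simp
  | add c d hc hd => rw [Finsupp.mapRange_add (map_add _)]; simp [hc, hd]
  | single i a => simp [Finsupp.mapRange_single]

theorem linearIndependent_mk_iff {J : Ideal A} {e : I → U} :
    LinearIndependent (A ⧸ J)
        (fun i => (Submodule.Quotient.mk (e i) : U ⧸ (J • ⊤ : Submodule A U))) ↔
      ∀ c : I →₀ A, Finsupp.linearCombination A e c ∈ J • (⊤ : Submodule A U) → ∀ i, c i ∈ J := by
  rw [linearIndependent_iff,
    (Finsupp.mapRange_surjective (Ideal.Quotient.mk J) (map_zero _)
      Ideal.Quotient.mk_surjective).forall]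
  simp [linearCombination_mk_mapRange, Submodule.Quotient.mk_eq_zero, Finsupp.ext_iff,
    Ideal.Quotient.eq_zero_iff_mem]

theorem span_mk_eq_top_iff {J : Ideal A} {e : I → U} :
    Submodule.span (A ⧸ J)
        (Set.range fun i => (Submodule.Quotient.mk (e i) : U ⧸ (J • ⊤ : Submodule A U))) = ⊤ ↔
      Submodule.span A (Set.range e) ⊔ J • ⊤ = ⊤ := by
  rw [← Submodule.restrictScalars_eq_top_iff A,
    Submodule.restrictScalars_span A (A ⧸ J) Ideal.Quotient.mk_surjective, sup_comm,
    ← Submodule.map_mkQ_eq_top, Submodule.map_span, ← Set.range_comp]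
  rfl

theorem equiv_apply_mem_smul_top_iff {V : Type*} [AddCommGroup V] [Module A V] (φ : U ≃ₗ[A] V)
    {J : Ideal A} {x : U} : φ x ∈ J • (⊤ : Submodule A V) ↔ x ∈ J • (⊤ : Submodule A U) :=
  ⟨fun h => by simpa using Submodule.smul_top_le_comap_smul_top J φ.symm.toLinearMap h,
    fun h => Submodule.smul_top_le_comap_smul_top J φ.toLinearMap h⟩

/-- A family in an `A`-module `U` whose image is a basis of `U ⧸ JⁿU` over `A ⧸ Jⁿ` for every `n`.
When `U` is `J`-adically complete, `U` is then the completion of the free module on the family. -/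
structure IsOrthonormalBasis (J : Ideal A) (e : I → U) : Prop where
  linearIndependent_mk (n : ℕ) : LinearIndependent (A ⧸ J ^ n)
    fun i => (Submodule.Quotient.mk (e i) : U ⧸ (J ^ n • ⊤ : Submodule A U))
  span_mk_eq_top (n : ℕ) : Submodule.span (A ⧸ J ^ n)
    (Set.range fun i => (Submodule.Quotient.mk (e i) : U ⧸ (J ^ n • ⊤ : Submodule A U))) = ⊤

theorem span_sup_pow_smul_top {N : Submodule A U} {J : Ideal A} (h : N ⊔ J • ⊤ = ⊤) (n : ℕ) :
    N ⊔ J ^ n • ⊤ = ⊤ := by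
  induction n with
  | zero => simp
  | succ n ih =>
    refine top_le_iff.1 (ih.symm.le.trans (sup_le le_sup_left ?_))
    conv_lhs => rw [← h]
    rw [Submodule.smul_sup, ← Submodule.mul_smul, ← pow_succ]
    exact sup_le (Submodule.smul_le_right.trans le_sup_left) le_sup_right

namespace IsOrthonormalBasis

theorem of_forall_free {J : Ideal A} {e : I → U}
    (hfree : ∀ n, Module.Free (A ⧸ J ^ n) (U ⧸ (J ^ n • ⊤ : Submodule A U)))
    (hli : LinearIndependent (A ⧸ J)
      fun i => (Submodule.Quotient.mk (e i) : U ⧸ (J • ⊤ : Submodule A U)))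
    (hspan : Submodule.span A (Set.range e) ⊔ J • ⊤ = ⊤) : IsOrthonormalBasis J e := by
  have hspan' (n : ℕ) := span_mk_eq_top_iff.2 (span_sup_pow_smul_top hspan n)
  refine ⟨fun n => ?_, hspan'⟩
  rcases n with _ | n
  · have : Subsingleton (A ⧸ J ^ 0) := Ideal.Quotient.subsingleton_iff.2 (by simp)
    exact linearIndependent_of_subsingleton
  have := hfree (n + 1)
  refine injective_of_ker_le_smul_top (𝔫 := J.map (Ideal.Quotient.mk (J ^ (n + 1)))) ?_
    ⟨n + 1, ?_⟩ fun x hx => ?_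
  · rw [← LinearMap.range_eq_top, Finsupp.range_linearCombination, hspan']
  · rw [← Ideal.map_pow, Ideal.map_quotient_self, Ideal.zero_eq_bot]
  · obtain ⟨c, rfl⟩ := Finsupp.mapRange_surjective (Ideal.Quotient.mk (J ^ (n + 1))) (map_zero _)
      Ideal.Quotient.mk_surjective x
    rw [LinearMap.mem_ker, linearCombination_mk_mapRange, Submodule.Quotient.mk_eq_zero] at hx
    have hc := linearIndependent_mk_iff.1 hli c
      (Submodule.smul_mono_left (Ideal.pow_le_self n.succ_ne_zero) hx)
    exact mem_smul_top_finsupp_iff.2 fun i => Ideal.mem_map_of_mem _ (hc i)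

theorem exists_of_forall_free {U : Type v} [AddCommGroup U] [Module A U] {J : Ideal A}
    (hfree : ∀ n, Module.Free (A ⧸ J ^ n) (U ⧸ (J ^ n • ⊤ : Submodule A U))) :
    ∃ (I : Type v) (e : I → U), IsOrthonormalBasis J e := by
  have : Module.Free (A ⧸ J) (U ⧸ (J • ⊤ : Submodule A U)) := by
    have := hfree 1
    rwa [pow_one] at this
  obtain ⟨⟨I, b⟩⟩ := Module.Free.exists_basis (A ⧸ J) (U ⧸ (J • ⊤ : Submodule A U))
  choose e he using fun i => Submodule.Quotient.mk_surjective _ (b i)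
  have he' : (fun i => Submodule.Quotient.mk (e i)) = b := funext he
  exact ⟨I, e, .of_forall_free hfree (he' ▸ b.linearIndependent)
    (span_mk_eq_top_iff.1 (he' ▸ b.span_eq))⟩

variable {J : Ideal A} {e : I → U} (he : IsOrthonormalBasis J e)
include he

theorem free (n : ℕ) : Module.Free (A ⧸ J ^ n) (U ⧸ (J ^ n • ⊤ : Submodule A U)) :=
  .of_basis (.mk (he.linearIndependent_mk n) (he.span_mk_eq_top n).ge)

theorem coeff_mem {n : ℕ} {c : I →₀ A}
    (hc : Finsupp.linearCombination A e c ∈ J ^ n • (⊤ : Submodule A U)) (i : I) : c i ∈ J ^ n :=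
  linearIndependent_mk_iff.1 (he.linearIndependent_mk n) c hc i

theorem exists_sub_mem (n : ℕ) (x : U) :
    ∃ c : I →₀ A, x - Finsupp.linearCombination A e c ∈ J ^ n • (⊤ : Submodule A U) := by
  have hx : x ∈ Submodule.span A (Set.range e) ⊔ J ^ n • ⊤ := by
    rw [span_mk_eq_top_iff.1 (he.span_mk_eq_top n)]
    trivial
  obtain ⟨y, hy, z, hz, rfl⟩ := Submodule.mem_sup.1 hx
  obtain ⟨c, rfl⟩ := (Finsupp.mem_span_range_iff_exists_finsupp).1 hy
  exact ⟨c, by simpa [Finsupp.linearCombination_apply] using hz⟩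

theorem map_equiv {V : Type*} [AddCommGroup V] [Module A V] (φ : U ≃ₗ[A] V) :
    IsOrthonormalBasis J (φ ∘ e) where
  linearIndependent_mk n := linearIndependent_mk_iff.2 fun c hc => he.coeff_mem <| by
    rwa [← φ.coe_coe, ← Finsupp.apply_linearCombination, φ.coe_coe,
      equiv_apply_mem_smul_top_iff] at hc
  span_mk_eq_top n := by
    have h := congrArg (Submodule.map (φ : U →ₗ[A] V))
      (span_mk_eq_top_iff.1 (he.span_mk_eq_top n))
    rw [Submodule.map_sup, Submodule.map_span, ← Set.range_comp, Submodule.map_smul'',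
      Submodule.map_top, LinearEquiv.range] at h
    exact span_mk_eq_top_iff.2 h

theorem hom_ext {V : Type*} [AddCommGroup V] [Module A V] [IsHausdorff J V] {f g : U →ₗ[A] V}
    (h : ∀ i, f (e i) = g (e i)) : f = g := by
  rw [← sub_eq_zero]
  ext x
  refine IsHausdorff.haus (I := J) inferInstance _ fun n => SModEq.zero.2 ?_
  obtain ⟨c, hc⟩ := he.exists_sub_mem n x
  have hfg : (f - g) (Finsupp.linearCombination A e c) = 0 := by
    simp [Finsupp.apply_linearCombination, Function.comp_def, h]
  simpa [-LinearMap.sub_apply, map_sub, hfg] using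
    Submodule.smul_top_le_comap_smul_top _ (f - g) hc

theorem bijective_adicCompletion_map :
    Function.Bijective (AdicCompletion.map J (Finsupp.linearCombination A e)) := by
  constructor
  · rw [injective_iff_map_eq_zero]
    intro x hx
    ext n
    obtain ⟨c, hc⟩ := Submodule.Quotient.mk_surjective _ (x.val n)
    have hcn : (Submodule.Quotient.mk (Finsupp.linearCombination A e c) :
        U ⧸ (J ^ n • ⊤ : Submodule A U)) = 0 := by
      have := congrArg (fun y => y.val n) hx
      rw [AdicCompletion.map_val_apply, ← hc] at this
      exact this
    rw [← hc]
    exact (Submodule.Quotient.mk_eq_zero _).2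
      (mem_smul_top_finsupp_iff.2 (he.coeff_mem ((Submodule.Quotient.mk_eq_zero _).1 hcn)))
  · refine AdicCompletion.map_surjective_of_mkQ_comp_surjective fun y => ?_
    obtain ⟨x, rfl⟩ := Submodule.Quotient.mk_surjective _ y
    obtain ⟨c, hc⟩ := he.exists_sub_mem 1 x
    exact ⟨c, ((Submodule.Quotient.eq _).2 (pow_one J ▸ hc)).symm⟩

/-- A complete module with an orthonormal basis is the completion of the free module on it. -/
def adicCompletionEquiv [IsAdicComplete J U] : AdicCompletion J (I →₀ A) ≃ₗ[A] U :=
  ((LinearEquiv.ofBijective _ he.bijective_adicCompletion_map).restrictScalars A).trans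
    (AdicCompletion.ofLinearEquiv J U).symm

theorem adicCompletionEquiv_of [IsAdicComplete J U] (c : I →₀ A) :
    he.adicCompletionEquiv (AdicCompletion.of J _ c) = Finsupp.linearCombination A e c :=
  (LinearEquiv.symm_apply_eq _).2 (AdicCompletion.map_of ..)

theorem exists_hom [IsAdicComplete J U] {V : Type*} [AddCommGroup V] [Module A V]
    [IsAdicComplete J V] (v : I → V) : ∃ f : U →ₗ[A] V, ∀ i, f (e i) = v i := by
  let extend : AdicCompletion J (I →₀ A) →ₗ[A] V :=
    (AdicCompletion.ofLinearEquiv J V).symm.toLinearMap ∘ₗ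
      (AdicCompletion.map J (Finsupp.linearCombination A v)).restrictScalars A
  have hextend (c : I →₀ A) :
      extend (AdicCompletion.of J _ c) = Finsupp.linearCombination A v c :=
    (LinearEquiv.symm_apply_eq _).2 (AdicCompletion.map_of ..)
  refine ⟨extend ∘ₗ he.adicCompletionEquiv.symm.toLinearMap, fun i => ?_⟩
  have hi : he.adicCompletionEquiv.symm (e i) =
      AdicCompletion.of J _ (Finsupp.single i 1) := by
    simp [LinearEquiv.symm_apply_eq, adicCompletionEquiv_of]
  simp [hi, hextend]

end IsOrthonormalBasis

theorem isOrthonormalBasis_single (J : Ideal A) (I : Type*) :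
    IsOrthonormalBasis J fun i : I => Finsupp.single i (1 : A) where
  linearIndependent_mk n := linearIndependent_mk_iff.2 fun c hc =>
    mem_smul_top_finsupp_iff.1 (by simpa [Finsupp.linearCombination_apply] using hc)
  span_mk_eq_top n := span_mk_eq_top_iff.2 <| by
    rw [← Finsupp.coe_basisSingleOne, Module.Basis.span_eq, top_sup_eq]

theorem IsOrthonormalBasis.adicCompletion_of {J : Ideal A} (hJ : J.FG) {e : I → U}
    (he : IsOrthonormalBasis J e) : IsOrthonormalBasis J fun i => AdicCompletion.of J U (e i) := by
  have hlc (c : I →₀ A) : Finsupp.linearCombination A (fun i => AdicCompletion.of J U (e i)) c =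
      AdicCompletion.of J U (Finsupp.linearCombination A e c) :=
    (Finsupp.apply_linearCombination A (AdicCompletion.of J U) e c).symm
  refine ⟨fun n => linearIndependent_mk_iff.2 fun c hc => ?_, fun n =>
    span_mk_eq_top_iff.2 (eq_top_iff.2 fun x _ => ?_)⟩
  · rw [hlc, AdicCompletion.pow_smul_top_eq_ker_eval hJ, LinearMap.mem_ker,
      AdicCompletion.eval_of, Submodule.mkQ_apply, Submodule.Quotient.mk_eq_zero] at hc
    exact he.coeff_mem hc
  · obtain ⟨y, hy⟩ := Submodule.Quotient.mk_surjective _ (AdicCompletion.eval J U n x)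
    obtain ⟨c, hc⟩ := he.exists_sub_mem n y
    have hcx : AdicCompletion.eval J U n
        (x - Finsupp.linearCombination A (fun i => AdicCompletion.of J U (e i)) c) = 0 := by
      rw [hlc, map_sub, ← hy, AdicCompletion.eval_of, Submodule.mkQ_apply,
        ← Submodule.Quotient.mk_sub, Submodule.Quotient.mk_eq_zero]
      exact hc
    refine Submodule.mem_sup.2 ⟨_, Finsupp.mem_span_range_iff_exists_finsupp.2 ⟨c, rfl⟩, _, ?_,
      add_sub_cancel _ x⟩
    rwa [AdicCompletion.pow_smul_top_eq_ker_eval hJ, LinearMap.mem_ker]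

theorem isAdicComplete_of_equiv {J : Ideal A} {V : Type*} [AddCommGroup V] [Module A V]
    (φ : U ≃ₗ[A] V) [IsAdicComplete J U] : IsAdicComplete J V := by
  rw [← AdicCompletion.of_bijective_iff]
  have h : AdicCompletion.of J V = (AdicCompletion.congr J φ).toLinearMap.restrictScalars A ∘ₗ
      AdicCompletion.of J U ∘ₗ φ.symm.toLinearMap := by
    ext x : 1
    exact (congrArg _ (φ.apply_symm_apply x)).symm.trans (AdicCompletion.map_of ..).symm
  rw [h]
  exact (AdicCompletion.congr J φ).bijective.comp
    ((AdicCompletion.of_bijective J U).comp φ.symm.bijective)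

end OrthonormalBasis

section BaseChange

variable {A A' : Type*} [CommRing A] [CommRing A'] [Algebra A A'] {I U : Type*} [AddCommGroup U]
  [Module A U]

theorem tmul_mem_smul_top {J : Ideal A} {J' : Ideal A'} (hJ : J ≤ J'.comap (algebraMap A A'))
    (b : A') {x : U} (hx : x ∈ J • (⊤ : Submodule A U)) :
    b ⊗ₜ x ∈ J' • (⊤ : Submodule A' (A' ⊗[A] U)) := by
  refine Submodule.smul_induction_on hx (fun a ha y _ => ?_) fun x y hx hy => ?_
  · rw [TensorProduct.tmul_smul, ← algebraMap_smul A' a (b ⊗ₜ[A] y)]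
    exact Submodule.smul_mem_smul (hJ ha) trivial
  · rw [TensorProduct.tmul_add]
    exact add_mem hx hy

theorem IsOrthonormalBasis.exists_baseChange_coord {J : Ideal A} {J' : Ideal A'}
    (hJ : J ≤ J'.comap (algebraMap A A')) {e : I → U} (he : IsOrthonormalBasis J e) (n : ℕ)
    (i : I) :
    ∃ coord : A' ⊗[A] U →ₗ[A'] A' ⧸ J' ^ n, ∀ c : I →₀ A',
      coord (Finsupp.linearCombination A' (fun j => 1 ⊗ₜ[A] e j) c) =
        Ideal.Quotient.mk (J' ^ n) (c i) := by
  classical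
  have hJn : J ^ n ≤ (J' ^ n).comap (Algebra.ofId A A') :=
    (Ideal.pow_right_mono hJ n).trans (Ideal.le_comap_pow _ n)
  let b := Module.Basis.mk (he.linearIndependent_mk n) (he.span_mk_eq_top n).ge
  have hb (j : I) : b j = Submodule.Quotient.mk (e j) := Module.Basis.mk_apply ..
  let coord : A' ⊗[A] U →ₗ[A'] A' ⧸ J' ^ n := LinearMap.liftBaseChange A'
    ((Ideal.quotientMapₐ (J' ^ n) (Algebra.ofId A A') hJn).toLinearMap ∘ₗ
      (b.coord i).restrictScalars A ∘ₗ Submodule.mkQ _)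
  have hcoord : coord ∘ (fun j => (1 : A') ⊗ₜ[A] e j) = fun j => Finsupp.single j 1 i := by
    funext j
    rw [Function.comp_apply, LinearMap.liftBaseChange_tmul, one_smul]
    simp only [LinearMap.comp_apply, Submodule.mkQ_apply, ← hb, LinearMap.restrictScalars_apply,
      Module.Basis.coord_apply, Module.Basis.repr_self, AlgHom.toLinearMap_apply]
    rw [Finsupp.single_apply, Finsupp.single_apply]
    split_ifs <;> simp
  refine ⟨coord, fun c => ?_⟩
  rw [Finsupp.apply_linearCombination, hcoord]
  simp only [Finsupp.linearCombination_apply, Finsupp.single_apply, Algebra.smul_def,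
    Ideal.Quotient.algebraMap_eq, mul_ite, mul_one, mul_zero, Finsupp.sum_ite_eq',
    Finsupp.mem_support_iff]
  exact ite_eq_left_iff.2 fun h => by rw [not_not.1 h, map_zero]

theorem IsOrthonormalBasis.baseChange {J : Ideal A} {J' : Ideal A'}
    (hJ : J ≤ J'.comap (algebraMap A A')) {e : I → U} (he : IsOrthonormalBasis J e) :
    IsOrthonormalBasis J' fun i => (1 : A') ⊗ₜ[A] e i where
  linearIndependent_mk n := by
    refine linearIndependent_mk_iff.2 fun c hc i => ?_
    obtain ⟨coord, hcoord⟩ := he.exists_baseChange_coord hJ n i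
    have h := Submodule.smul_top_le_comap_smul_top _ coord hc
    rw [Submodule.mem_comap, hcoord, Ideal.smul_top_eq_map,
      Ideal.Quotient.algebraMap_eq, Ideal.map_quotient_self] at h
    exact Ideal.Quotient.eq_zero_iff_mem.1 h
  span_mk_eq_top n := by
    refine span_mk_eq_top_iff.2 (Submodule.eq_top_iff'.2 fun z => ?_)
    induction z using TensorProduct.induction_on with
    | zero => exact zero_mem _
    | add y z hy hz => exact add_mem hy hz
    | tmul a x =>
      obtain ⟨c, hc⟩ := he.exists_sub_mem n x
      rw [← sub_add_cancel x (Finsupp.linearCombination A e c), TensorProduct.tmul_add]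
      refine add_mem (Submodule.mem_sup_right ?_) (Submodule.mem_sup_left ?_)
      · exact tmul_mem_smul_top ((Ideal.pow_right_mono hJ n).trans (Ideal.le_comap_pow _ n)) a hc
      · have hspan := Submodule.tmul_mem_baseChange_of_mem a
          (Finsupp.mem_span_range_iff_exists_finsupp.2 ⟨c, rfl⟩ :
            Finsupp.linearCombination A e c ∈ Submodule.span A (Set.range e))
        rw [Submodule.baseChange_span, ← Set.range_comp] at hspan
        exact hspan

end BaseChange

section LinearTopology

theorem isLinearTopology_induced {R M N : Type*} [Ring R] [AddCommGroup M] [Module R M]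
    [AddCommGroup N] [Module R N] [TopologicalSpace N] [IsLinearTopology R N] (f : M →ₗ[R] N) :
    @IsLinearTopology R M _ _ _ (.induced f inferInstance) := by
  let : TopologicalSpace M := .induced f inferInstance
  have hbasis : (𝓝 (0 : M)).HasBasis (fun N' : Submodule R N => (N' : Set N) ∈ 𝓝 0)
      fun N' => (N'.comap f : Set M) := by
    rw [nhds_induced, map_zero]
    exact (IsLinearTopology.hasBasis_submodule R).comap f
  exact IsLinearTopology.mk_of_hasBasis R hbasis

theorem isLinearTopology_pi {R ι : Type*} [Ring R] {M : ι → Type*} [∀ i, AddCommGroup (M i)]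
    [∀ i, Module R (M i)] [∀ i, TopologicalSpace (M i)] [∀ i, IsLinearTopology R (M i)] :
    IsLinearTopology R (∀ i, M i) := by
  have hbasis : (𝓝 (0 : ∀ i, M i)).HasBasis
      (fun S : Set ι × (∀ i, Submodule R (M i)) =>
        S.1.Finite ∧ ∀ i ∈ S.1, (S.2 i : Set (M i)) ∈ 𝓝 0)
      fun S => (Submodule.pi S.1 S.2 : Set (∀ i, M i)) := by
    rw [nhds_pi]
    exact Filter.hasBasis_pi fun i => IsLinearTopology.hasBasis_submodule R
  exact IsLinearTopology.mk_of_hasBasis R hbasis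

/-- A continuous linear bijection from a compact module to a Hausdorff module, as an isomorphism of
topological modules. -/
def continuousLinearEquivOfBijective {A M N : Type*} [Semiring A] [AddCommMonoid M]
    [Module A M] [TopologicalSpace M] [AddCommMonoid N] [Module A N] [TopologicalSpace N]
    [CompactSpace M] [T2Space N] (f : M →L[A] N) (hf : Function.Bijective f) : M ≃L[A] N where
  toLinearEquiv := LinearEquiv.ofBijective f.toLinearMap hf
  continuous_toFun := f.continuous
  continuous_invFun := Continuous.continuous_symm_of_equiv_compact_to_t2
    (f := (LinearEquiv.ofBijective f.toLinearMap hf).toEquiv) f.continuous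

end LinearTopology

namespace IsCompleteNoetherianLocal

variable {A : Type u} [CommRing A] [TopologicalSpace A] [IsCompleteNoetherianLocal A]

instance : IsAdicComplete (maximalIdeal A) A := isAdicComplete

theorem isOpen_maximalIdeal_pow (n : ℕ) : IsOpen ((maximalIdeal A ^ n : Ideal A) : Set A) :=
  (isAdic_iff.1 isAdic).1 n

theorem hasBasis_nhds_zero :
    (𝓝 (0 : A)).HasBasis (fun _ : ℕ => True) fun n => ((maximalIdeal A ^ n : Ideal A) : Set A) :=
  isAdic.hasBasis_nhds_zero

instance : IsLinearTopology A A := IsLinearTopology.mk_of_hasBasis A hasBasis_nhds_zero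

instance : NonarchimedeanRing A where
  is_nonarchimedean U hU := by
    obtain ⟨n, -, hn⟩ := hasBasis_nhds_zero.mem_iff.1 hU
    exact ⟨⟨(maximalIdeal A ^ n).toAddSubgroup, isOpen_maximalIdeal_pow n⟩, hn⟩

instance (n : ℕ) : Finite (A ⧸ maximalIdeal A ^ n) :=
  have : Finite (ResidueField A) := finite_residueField
  finite_quotient_iff.2 ⟨n, le_rfl⟩

instance : T2Space A := by
  let : UniformSpace A := IsTopologicalAddGroup.rightUniformSpace A
  have : IsUniformAddGroup A := isUniformAddGroup_of_addCommGroup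
  exact ((isAdic (A := A)).isAdicComplete_iff.1 inferInstance).2

instance : CompactSpace A := by
  let : UniformSpace A := IsTopologicalAddGroup.rightUniformSpace A
  have : IsUniformAddGroup A := isUniformAddGroup_of_addCommGroup
  have hcomplete : CompleteSpace A := ((isAdic (A := A)).isAdicComplete_iff.1 inferInstance).1
  refine ⟨isCompact_iff_totallyBounded_isComplete.2
    ⟨?_, completeSpace_iff_isComplete_univ.1 hcomplete⟩⟩
  rw [totallyBounded_iff_subset_finite_iUnion_nhds_zero]
  intro U hU
  obtain ⟨n, -, hn⟩ := hasBasis_nhds_zero.mem_iff.1 hU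
  refine ⟨Set.range fun q : A ⧸ maximalIdeal A ^ n => Quotient.out q, Set.finite_range _,
    fun a _ => Set.mem_iUnion₂.2 ⟨_, ⟨Ideal.Quotient.mk _ a, rfl⟩, Set.mem_vadd_set.2
      ⟨a - Quotient.out (Ideal.Quotient.mk (maximalIdeal A ^ n) a), hn ?_, by simp⟩⟩⟩
  exact (Ideal.Quotient.mk_eq_mk_iff_sub_mem _ _).1 (Ideal.Quotient.mk_out _).symm

end IsCompleteNoetherianLocal

open IsCompleteNoetherianLocal

section ProfiniteModule

variable {A : Type u} [CommRing A] {M N : Type v} [AddCommGroup M] [Module A M] [TopologicalSpace M]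
  [AddCommGroup N] [Module A N] [TopologicalSpace N]

theorem IsProfiniteModule.of_equiv (hM : IsProfiniteModule A M) (e : M ≃L[A] N) :
    IsProfiniteModule A N where
  compactSpace :=
    have := hM.compactSpace
    e.toHomeomorph.compactSpace
  t2Space :=
    have := hM.t2Space
    e.toHomeomorph.t2Space
  totallyDisconnectedSpace :=
    have := hM.totallyDisconnectedSpace
    e.toHomeomorph.totallyDisconnectedSpace
  isLinearTopology := by
    have := hM.isLinearTopology
    rw [e.symm.toHomeomorph.isInducing.eq_induced]
    exact isLinearTopology_induced e.symm.toLinearMap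

end ProfiniteModule

section PointwiseDual

namespace PointwiseDual

variable {A : Type u} [CommRing A] {U : Type v} [AddCommGroup U] [Module A U]

theorem range_incl : Set.range (incl A U) =
    {f | (∀ x y, f (x + y) = f x + f y) ∧ ∀ (a : A) x, f (a • x) = a * f x} := by
  ext f
  constructor
  · rintro ⟨f, rfl⟩
    exact ⟨fun x y => map_add (show Module.Dual A U from f) x y,
      fun a x => map_smul (show Module.Dual A U from f) a x⟩
  · rintro ⟨hadd, hsmul⟩
    exact ⟨show Module.Dual A U from ⟨⟨f, hadd⟩, hsmul⟩, rfl⟩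

variable [TopologicalSpace A]

theorem isEmbedding_incl : IsEmbedding (incl A U) :=
  ⟨⟨rfl⟩, fun _ _ h => ext (congrFun h)⟩

theorem isClosedEmbedding_incl [IsTopologicalRing A] [T2Space A] :
    IsClosedEmbedding (incl A U) := by
  refine ⟨isEmbedding_incl, range_incl (A := A) (U := U) ▸ ?_⟩
  simp only [Set.ofPred_and, Set.ofPred_forall]
  refine .inter (isClosed_iInter fun x => isClosed_iInter fun y => isClosed_eq ?_ ?_)
    (isClosed_iInter fun a => isClosed_iInter fun x => isClosed_eq ?_ ?_) <;> fun_prop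

theorem isProfiniteModule [IsCompleteNoetherianLocal A] :
    IsProfiniteModule A (PointwiseDual A U) where
  compactSpace := isClosedEmbedding_incl.compactSpace
  t2Space := isEmbedding_incl.t2Space
  totallyDisconnectedSpace := ⟨isEmbedding_incl.isTotallyDisconnected
    (isTotallyDisconnected_of_totallyDisconnectedSpace _)⟩
  isLinearTopology :=
    have := isLinearTopology_pi (R := A) (M := fun _ : U => A)
    isLinearTopology_induced (incl A U)

variable (A) in
/-- Restriction of linear forms to a family of vectors. -/
def restrict {I : Type*} (e : I → U) : PointwiseDual A U →L[A] (I → A) where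
  toFun f i := f (e i)
  map_add' _ _ := rfl
  map_smul' _ _ := rfl
  cont := continuous_pi fun i => continuous_eval (e i)

end PointwiseDual

variable {A : Type u} [CommRing A] [TopologicalSpace A] [IsCompleteNoetherianLocal A]
  {U : Type v} [AddCommGroup U] [Module A U] {I : Type*} {e : I → U}

theorem IsOrthonormalBasis.bijective_restrict [IsAdicComplete (maximalIdeal A) U]
    (he : IsOrthonormalBasis (maximalIdeal A) e) :
    Function.Bijective (PointwiseDual.restrict A e) :=
  ⟨fun _ _ hfg => he.hom_ext (congrFun hfg), fun c => (he.exists_hom c).imp fun _ hf => funext hf⟩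

/-- A linear form is determined by its values on an orthonormal basis, which are arbitrary. -/
def IsOrthonormalBasis.dualEquiv [IsAdicComplete (maximalIdeal A) U]
    (he : IsOrthonormalBasis (maximalIdeal A) e) : PointwiseDual A U ≃L[A] (I → A) :=
  have := (PointwiseDual.isProfiniteModule (A := A) (U := U)).compactSpace
  continuousLinearEquivOfBijective (PointwiseDual.restrict A e) he.bijective_restrict

end PointwiseDual

section Pi

variable {I : Type*} [DecidableEq I]

theorem tendsto_pi_single_cofinite {M : I → Type*} [∀ i, Zero (M i)]
    [∀ i, TopologicalSpace (M i)] (g : ∀ i, M i) :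
    Filter.Tendsto (fun i => Pi.single i (g i)) Filter.cofinite (𝓝 (0 : ∀ i, M i)) :=
  tendsto_pi_nhds.2 fun j => tendsto_nhds_of_eventually_eq <|
    (Set.finite_singleton j).subset fun _ hi => of_not_not fun hij =>
      hi (Pi.single_eq_of_ne (Ne.symm hij) _)

theorem hasSum_pi_single_self {M : I → Type*} [∀ i, AddCommMonoid (M i)]
    [∀ i, TopologicalSpace (M i)] (g : ∀ i, M i) : HasSum (fun i => Pi.single i (g i)) g :=
  Pi.hasSum.2 fun i => by
    simpa using hasSum_single (f := fun j => (Pi.single j (g j) : ∀ i, M i) i) i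
      fun j hj => Pi.single_eq_of_ne hj.symm _

theorem continuousLinearMap_pi_ext {A N : Type*} [Semiring A] [TopologicalSpace A]
    [AddCommMonoid N] [Module A N] [TopologicalSpace N] [T2Space N] {f g : (I → A) →L[A] N}
    (h : ∀ i, f (Pi.single i 1) = g (Pi.single i 1)) : f = g := by
  ext c
  have hterm (i : I) : f (Pi.single i (c i)) = g (Pi.single i (c i)) := by
    rw [← mul_one (c i), ← smul_eq_mul, Pi.single_smul, map_smul, map_smul, h]
  refine ((hasSum_pi_single_self c).mapL f).unique ?_
  simpa only [hterm] using (hasSum_pi_single_self c).mapL g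

end Pi

section BidualEval

theorem exists_sub_sum_mem {A U I : Type*} [CommRing A] [AddCommGroup U] [Module A U] {J : Ideal A}
    [IsAdicComplete J U] {c : I → A} (hc : ∀ n, {i | c i ∉ J ^ n}.Finite) (e : I → U) :
    ∃ x : U, ∀ n (s : Finset I), (∀ i ∉ s, c i ∈ J ^ n) →
      x - ∑ i ∈ s, c i • e i ∈ J ^ n • (⊤ : Submodule A U) := by
  classical
  have hsum {n : ℕ} {s t : Finset I} (hs : ∀ i ∉ s, c i ∈ J ^ n) (ht : ∀ i ∉ t, c i ∈ J ^ n) :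
      ∑ i ∈ s, c i • e i - ∑ i ∈ t, c i • e i ∈ J ^ n • (⊤ : Submodule A U) := by
    rw [← Finset.sum_sdiff_sub_sum_sdiff]
    refine sub_mem (sum_mem fun i hi => ?_) (sum_mem fun i hi => ?_)
    · exact Submodule.smul_mem_smul (ht i (Finset.mem_sdiff.1 hi).2) trivial
    · exact Submodule.smul_mem_smul (hs i (Finset.mem_sdiff.1 hi).2) trivial
  have hsupp {m n : ℕ} (hmn : m ≤ n) : ∀ i ∉ (hc n).toFinset, c i ∈ J ^ m := fun i hi =>
    Ideal.pow_le_pow_right hmn (by simpa using hi)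
  obtain ⟨x, hx⟩ := IsPrecomplete.prec (I := J) inferInstance
    (f := fun n => ∑ i ∈ (hc n).toFinset, c i • e i)
    fun hmn => SModEq.sub_mem.2 (hsum (hsupp le_rfl) (hsupp hmn))
  refine ⟨x, fun n s hs => ?_⟩
  simpa using add_mem (SModEq.sub_mem.1 (hx n).symm) (hsum (hsupp le_rfl) hs)

theorem apply_mem_of_mem_smul_top {A U : Type*} [CommRing A] [AddCommGroup U] [Module A U]
    {J : Ideal A} (f : U →ₗ[A] A) {x : U} (hx : x ∈ J • (⊤ : Submodule A U)) : f x ∈ J := by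
  simpa using Submodule.smul_top_le_comap_smul_top J f hx

theorem IsOrthonormalBasis.mem_pow_smul_top_iff {A U I : Type*} [CommRing A] [AddCommGroup U]
    [Module A U] {J : Ideal A} [IsAdicComplete J A] [IsAdicComplete J U] {e : I → U}
    (he : IsOrthonormalBasis J e) {n : ℕ} {x : U} :
    x ∈ J ^ n • (⊤ : Submodule A U) ↔ ∀ f : U →ₗ[A] A, f x ∈ J ^ n := by
  classical
  refine ⟨fun hx f => apply_mem_of_mem_smul_top f hx, fun h => ?_⟩
  obtain ⟨c, hc⟩ := he.exists_sub_mem n x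
  suffices hcomb : Finsupp.linearCombination A e c ∈ J ^ n • (⊤ : Submodule A U) by
    simpa using add_mem hc hcomb
  refine sum_mem fun i _ => Submodule.smul_mem_smul ?_ trivial
  obtain ⟨f, hf⟩ := he.exists_hom (Pi.single i (1 : A))
  have hfc : f (Finsupp.linearCombination A e c) = c i := by
    rw [Finsupp.apply_linearCombination, show ⇑f ∘ e = Pi.single i 1 from funext hf]
    simp [Finsupp.linearCombination_apply, Finsupp.sum, Pi.single_apply, eq_comm]
  simpa [hfc] using sub_mem (h f) (apply_mem_of_mem_smul_top f hc)

variable (A : Type u) [CommRing A] [TopologicalSpace A] [IsTopologicalRing A]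

/-- The evaluation map of a module into the continuous dual of its dual. -/
def bidualEval (U : Type v) [AddCommGroup U] [Module A U] :
    U →ₗ[A] (PointwiseDual A U →L[A] A) where
  toFun x :=
    { toFun := fun f => f x
      map_add' := fun _ _ => rfl
      map_smul' := fun _ _ => rfl
      cont := PointwiseDual.continuous_eval x }
  map_add' x y := by
    ext f
    exact map_add (show Module.Dual A U from f) x y
  map_smul' a x := by
    ext f
    exact map_smul (show Module.Dual A U from f) a x

/-- The evaluation map of a topological module into the dual of its continuous dual. -/
def contBidualEval (M : Type v) [AddCommGroup M] [Module A M] [TopologicalSpace M] (m : M) :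
    PointwiseDual A (M →L[A] A) :=
  show Module.Dual A (M →L[A] A) from
    { toFun := fun f => f m
      map_add' := fun _ _ => rfl
      map_smul' := fun _ _ => rfl }

end BidualEval

section BidualEval

variable {A : Type u} [CommRing A] [TopologicalSpace A] [IsCompleteNoetherianLocal A]

theorem IsOrthonormalBasis.bijective_bidualEval {U : Type v} [AddCommGroup U] [Module A U]
    [IsAdicComplete (maximalIdeal A) U] {I : Type*} {e : I → U}
    (he : IsOrthonormalBasis (maximalIdeal A) e) : Function.Bijective (bidualEval A U) := by
  classical
  refine ⟨(injective_iff_map_eq_zero _).2 fun x hx => ?_, fun F => ?_⟩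
  · refine IsHausdorff.haus (I := maximalIdeal A) inferInstance x fun n =>
      SModEq.zero.2 (he.mem_pow_smul_top_iff.2 fun f => ?_)
    exact (DFunLike.congr_fun hx (show PointwiseDual A U from f)).symm ▸ zero_mem _
  · let F' : (I → A) →L[A] A := F ∘L he.dualEquiv.symm
    let c (i : I) : A := F' (Pi.single i 1)
    have hc : Filter.Tendsto c Filter.cofinite (𝓝 0) := by
      simpa [c, Function.comp_def] using
        (F'.continuous.tendsto 0).comp (tendsto_pi_single_cofinite fun _ => (1 : A))
    have hc' (n : ℕ) : {i | c i ∉ maximalIdeal A ^ n}.Finite :=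
      IsCompleteNoetherianLocal.hasBasis_nhds_zero.tendsto_right_iff.1 hc n trivial
    obtain ⟨x, hx⟩ := exists_sub_sum_mem hc' e
    have hF' : bidualEval A U x ∘L (he.dualEquiv.symm : (I → A) →L[A] PointwiseDual A U) = F' := by
      refine continuousLinearMap_pi_ext fun i => sub_eq_zero.1 ?_
      refine IsHausdorff.haus (I := maximalIdeal A) inferInstance _ fun n => SModEq.zero.2 ?_
      let f : U →ₗ[A] A := he.dualEquiv.symm (Pi.single i 1)
      have hf (j : I) : f (e j) = (Pi.single i 1 : I → A) j :=
        congrFun (he.dualEquiv.apply_symm_apply (Pi.single i 1)) j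
      have hfx : f x - c i ∈ maximalIdeal A ^ n := by
        simpa [hf, Pi.single_apply] using apply_mem_of_mem_smul_top f
          (hx n (insert i (hc' n).toFinset) fun j hj => by simp_all)
      rw [smul_eq_mul, Ideal.mul_top]
      exact hfx
    refine ⟨x, ContinuousLinearMap.ext fun f => ?_⟩
    simpa [F'] using DFunLike.congr_fun hF' (he.dualEquiv f)

section ContinuousDual

variable {M : Type v} [AddCommGroup M] [Module A M] [TopologicalSpace M] {I : Type*}

instance (U : Type*) [AddCommGroup U] [Module A U] :
    IsAdicComplete (maximalIdeal A) (AdicCompletion (maximalIdeal A) U) :=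
  AdicCompletion.isAdicComplete (maximalIdeal A).fg_of_isNoetherianRing

/-- The continuous dual of `A^I` is the completed free module on `I`. -/
def continuousDualEquiv (ν : M ≃L[A] (I → A)) :
    AdicCompletion (maximalIdeal A) (I →₀ A) ≃ₗ[A] (M →L[A] A) :=
  have he := (isOrthonormalBasis_single (maximalIdeal A) I).adicCompletion_of
    (maximalIdeal A).fg_of_isNoetherianRing
  (LinearEquiv.ofBijective _ he.bijective_bidualEval).trans
    ((he.dualEquiv.trans ν.symm).arrowCongrEquivₛₗ (.refl A A))

theorem isAdicComplete_continuousDual (ν : M ≃L[A] (I → A)) :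
    IsAdicComplete (maximalIdeal A) (M →L[A] A) :=
  isAdicComplete_of_equiv (continuousDualEquiv ν)

theorem isOrthonormalBasis_proj_comp (ν : M ≃L[A] (I → A)) :
    IsOrthonormalBasis (maximalIdeal A)
      fun i => (ContinuousLinearMap.proj i : (I → A) →L[A] A) ∘L (ν : M →L[A] (I → A)) := by
  have he := (isOrthonormalBasis_single (maximalIdeal A) I).adicCompletion_of
    (maximalIdeal A).fg_of_isNoetherianRing
  convert he.map_equiv (continuousDualEquiv ν) using 1
  ext i m
  exact (congrFun (he.dualEquiv.apply_symm_apply (ν m)) i).symm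

theorem isOrthonormalizable_continuousDual (ν : M ≃L[A] (I → A)) :
    IsOrthonormalizable A (M →L[A] A) :=
  ⟨isAdicComplete_continuousDual ν, (isOrthonormalBasis_proj_comp ν).free⟩

theorem bijective_contBidualEval (ν : M ≃L[A] (I → A)) :
    Function.Bijective (contBidualEval A M) := by
  have := isAdicComplete_continuousDual ν
  have h : (isOrthonormalBasis_proj_comp ν).dualEquiv ∘ contBidualEval A M = ν := rfl
  exact (Function.Bijective.of_comp_iff' (EquivLike.bijective _) _).1 (h ▸ ν.bijective)

theorem mem_pow_smul_top_continuousDual_iff (ν : M ≃L[A] (I → A)) {n : ℕ} {f : M →L[A] A} :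
    f ∈ maximalIdeal A ^ n • (⊤ : Submodule A (M →L[A] A)) ↔ ∀ m, f m ∈ maximalIdeal A ^ n := by
  have := isAdicComplete_continuousDual ν
  rw [(isOrthonormalBasis_proj_comp ν).mem_pow_smul_top_iff]
  exact (bijective_contBidualEval ν).surjective.forall

end ContinuousDual

end BidualEval

section Continuity

theorem hasBasis_nhds_adicModuleTopology {A U : Type*} [CommRing A] (J : Ideal A) [AddCommGroup U]
    [Module A U] (x : U) : (@nhds U (J.adicModuleTopology U) x).HasBasis (fun _ : ℕ => True)
      fun n => {y | y - x ∈ J ^ n • (⊤ : Submodule A U)} := by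
  let := J.adicTopology
  refine ((J.ringFilterBasis.moduleFilterBasis
    (J.adic_module_basis U)).toAddGroupFilterBasis.nhds_hasBasis x).to_hasBasis ?_
    fun n _ => ⟨_, ⟨n, rfl⟩, ?_⟩
  · rintro _ ⟨n, rfl⟩
    exact ⟨n, trivial, fun y hy => ⟨y - x, hy, by simp⟩⟩
  · rintro _ ⟨y, hy, rfl⟩
    simpa using hy

variable {G : Type w} [Group G] [TopologicalSpace G] [IsTopologicalGroup G]

theorem isAdicallyContinuous_iff {A : Type u} [CommRing A] [IsLocalRing A] (π : Rep.{v} A G) :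
    IsAdicallyContinuous π ↔ IsAdicComplete (maximalIdeal A) π ∧ ∀ (x : π) (n : ℕ),
      ∀ᶠ g in 𝓝 (1 : G), π.ρ g x - x ∈ maximalIdeal A ^ n • (⊤ : Submodule A π) := by
  refine and_congr_right fun _ => ?_
  let : TopologicalSpace π := (maximalIdeal A).adicModuleTopology π
  have hbasis := hasBasis_nhds_adicModuleTopology (maximalIdeal A) (U := π)
  refine ⟨fun h x n => ?_, fun h => continuous_iff_continuousAt.2 fun ⟨g, x⟩ =>
    (hbasis _).tendsto_right_iff.2 fun n _ => ?_⟩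
  · have hx : Filter.Tendsto (fun g : G => π.ρ g x) (𝓝 1) (𝓝 x) := by
      simpa [Function.comp_def] using
        (h.comp (continuous_id.prodMk (continuous_const (y := x)))).tendsto (1 : G)
    exact hx ((hbasis x).mem_of_mem (i := n) trivial)
  · have hg : Filter.Tendsto (fun g' : G => g⁻¹ * g') (𝓝 g) (𝓝 1) := by
      simpa using (continuous_const_mul g⁻¹).tendsto g
    rw [nhds_prod_eq]
    filter_upwards [(hg.eventually (h x n)).prod_mk ((hbasis x).mem_of_mem (i := n) trivial)]
      with ⟨g', y⟩ ⟨hg', hy⟩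
    have hsplit : π.ρ g' y - π.ρ g x = π.ρ g' (y - x) + π.ρ g (π.ρ (g⁻¹ * g') x - x) := by
      rw [map_sub, map_sub, ← Module.End.mul_apply (π.ρ g), ← map_mul, mul_inv_cancel_left,
        sub_add_sub_cancel]
    change π.ρ g' y - π.ρ g x ∈ _
    rw [hsplit]
    exact add_mem (Submodule.smul_top_le_comap_smul_top _ (π.ρ g') hy)
      (Submodule.smul_top_le_comap_smul_top _ (π.ρ g) hg')

theorem continuous_toCompletedGroupAlgebra_of (A : Type u) [CommRing A] [TopologicalSpace A]
    (K : Type w) [Group K] [TopologicalSpace K] [IsTopologicalGroup K] :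
    Continuous fun k : K => toCompletedGroupAlgebra A K (MonoidAlgebra.of A K k) := by
  refine continuous_induced_rng.2 (continuous_pi fun V => continuous_pi fun q => ?_)
  have : DiscreteTopology (K ⧸ V.toSubgroup) := QuotientGroup.discreteTopology V.isOpen'
  have hcoeff : Continuous fun r : K ⧸ V.toSubgroup => (MonoidAlgebra.single r (1 : A)).coeff q :=
    continuous_of_discreteTopology
  convert hcoeff.comp (continuous_quot_mk : Continuous (QuotientGroup.mk (s := V.toSubgroup)))
    using 2 with k
  change (MonoidAlgebra.mapDomainRingHom A (QuotientGroup.mk' V.toSubgroup)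
    (MonoidAlgebra.of A K k)).coeff q = _
  simp
  rfl

variable {A : Type u} [CommRing A] [TopologicalSpace A]

theorem IsAugmented.continuous_act {M : TopRep.{v} A G} (hM : IsAugmented M) :
    Continuous fun p : G × M => M.ρ p.1 p.2 := by
  obtain ⟨K, hKo, -, hmod, hact, hcont⟩ := hM
  have hK : Continuous fun p : K × M => M.ρ (p.1 : G) p.2 := by
    convert hcont.comp (((continuous_toCompletedGroupAlgebra_of A K).comp
      continuous_fst).prodMk continuous_snd) using 2 with p
    exact .symm <| (hact _ _).trans (by rw [Representation.asAlgebraHom_of]; rfl)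
  refine continuous_iff_continuousAt.2 fun ⟨g, m⟩ => ?_
  have htranslate : IsOpenEmbedding (Prod.map (fun k : K => g * k) (id : M → M)) :=
    ((Homeomorph.mulLeft g).isOpenEmbedding.comp hKo.isOpenEmbedding_subtypeVal).prodMap .id
  have hg : Continuous fun p : K × M => M.ρ (g * p.1) p.2 := by
    simpa [Function.comp_def] using (M.ρ g).continuous.comp hK
  simpa using htranslate.continuousAt_iff (g := fun p : G × M => M.ρ p.1 p.2) |>.1
    (hg.continuousAt (x := (1, m)))

theorem IsAugmented.eventually_forall_apply_sub_mem {M : TopRep.{v} A G} (hM : IsAugmented M)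
    [CompactSpace M] [IsTopologicalRing A] (f : M →L[A] A) {W : Set A} (hW : W ∈ 𝓝 0) :
    ∀ᶠ g in 𝓝 (1 : G), ∀ m, f (M.ρ g⁻¹ m) - f m ∈ W := by
  have hcont : Continuous fun p : G × M => f (M.ρ p.1⁻¹ p.2) - f p.2 :=
    (f.continuous.comp (hM.continuous_act.comp (by fun_prop : Continuous fun p : G × M =>
      (p.1⁻¹, p.2)))).sub (f.continuous.comp continuous_snd)
  have h := isCompact_univ.eventually_forall_of_forall_eventually (x₀ := (1 : G))
    (P := fun g (m : M) => f (M.ρ g⁻¹ m) - f m ∈ W) fun m _ =>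
      hcont.continuousAt.eventually_mem (by simpa using hW)
  simpa using h

theorem contFl_contDual [IsCompleteNoetherianLocal A] {M : TopRep.{u} A G}
    (hM : proAugFl A G M) : contFl A G ((contDualFunctor A G).obj (.op M)) := by
  obtain ⟨⟨hprof, haug⟩, I, ⟨ν⟩⟩ := hM
  have := hprof.compactSpace
  have hortho : IsOrthonormalizable A (M →L[A] A) := isOrthonormalizable_continuousDual ν
  refine ⟨(isAdicallyContinuous_iff _).2 ⟨hortho.1, fun (f : M →L[A] A) n => ?_⟩, hortho⟩
  filter_upwards [haug.eventually_forall_apply_sub_mem f (hasBasis_nhds_zero.mem_of_mem (i := n)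
    trivial)] with g hg
  exact (mem_pow_smul_top_continuousDual_iff ν).2 hg

end Continuity

section CompactOpenSubgroup

open scoped Pointwise in
theorem exists_subgroup_isOpen_isCompact (G : Type*) [Group G] [TopologicalSpace G]
    [IsTopologicalGroup G] [T2Space G] [LocallyCompactSpace G] [TotallyDisconnectedSpace G] :
    ∃ K : Subgroup G, IsOpen (K : Set G) ∧ IsCompact (K : Set G) := by
  obtain ⟨C, hC, hC1⟩ := exists_compact_mem_nhds (1 : G)
  obtain ⟨W, hW, h1W, hWC⟩ := loc_compact_Haus_tot_disc_of_zero_dim.mem_nhds_iff.1 hC1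
  have hWcompact : IsCompact W := hC.of_isClosed_subset hW.1 hWC
  have hopen : IsOpen (MulAction.stabilizer G W : Set G) := by
    refine Subgroup.isOpen_of_mem_nhds _ (g := 1) ?_
    filter_upwards [hWcompact.eventually_forall_of_forall_eventually
      (P := fun g x => g * x ∈ W ∧ g⁻¹ * x ∈ W) fun x hx =>
        .and (ContinuousAt.eventually_mem (f := fun p : G × G => p.1 * p.2) (by fun_prop)
          (hW.2.mem_nhds (by simpa using hx)))
        (ContinuousAt.eventually_mem (f := fun p : G × G => p.1⁻¹ * p.2) (by fun_prop)
          (hW.2.mem_nhds (by simpa using hx)))] with g hg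
    exact MulAction.mem_stabilizer_set.2 fun x =>
      ⟨fun hx => by simpa using (hg _ hx).2, fun hx => (hg x hx).1⟩
  have hclosed := Subgroup.isClosed_of_isOpen _ hopen
  refine ⟨_, hopen, hWcompact.of_isClosed_subset hclosed fun g hg => ?_⟩
  simpa using (MulAction.mem_stabilizer_set.1 hg 1).2 h1W

end CompactOpenSubgroup

section CompletedAction

variable {A : Type*} [CommRing A] {K : Type*} [Group K] [TopologicalSpace K]

namespace CompletedGroupAlgebra

variable (A) in
theorem surjective_mapDomainRingHom_mk (V : OpenNormalSubgroup K) :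
    Function.Surjective (MonoidAlgebra.mapDomainRingHom A (QuotientGroup.mk' V.toSubgroup)) := by
  intro a
  induction a using MonoidAlgebra.induction_linear with
  | zero => exact ⟨0, map_zero _⟩
  | add a b ha hb =>
    obtain ⟨⟨x, rfl⟩, y, rfl⟩ := And.intro ha hb
    exact ⟨x + y, map_add _ _ _⟩
  | single q c =>
    obtain ⟨k, rfl⟩ := QuotientGroup.mk'_surjective _ q
    exact ⟨.single k c, by simp⟩

theorem exists_mapDomainRingHom_eq (l : CompletedGroupAlgebra A K) (V : OpenNormalSubgroup K) :
    ∃ x : MonoidAlgebra A K, ∀ V', V ≤ V' →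
      MonoidAlgebra.mapDomainRingHom A (QuotientGroup.mk' V'.toSubgroup) x = l.1 V' := by
  obtain ⟨x, hx⟩ := surjective_mapDomainRingHom_mk A V (l.1 V)
  refine ⟨x, fun V' h => ?_⟩
  rw [← l.2 V V' h, ← hx]
  exact ((toCompletedGroupAlgebra A K x).2 V V' h).symm

theorem continuous_coeff [TopologicalSpace A] (V : OpenNormalSubgroup K) (q : K ⧸ V.toSubgroup) :
    Continuous fun l : CompletedGroupAlgebra A K => (l.1 V).coeff q := by
  have h : Continuous fun (l : CompletedGroupAlgebra A K) (V : OpenNormalSubgroup K)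
      (q : K ⧸ V.toSubgroup) => (l.1 V).coeff q := continuous_induced_dom
  exact continuous_pi_iff.1 (continuous_pi_iff.1 h V) q

end CompletedGroupAlgebra

variable {M : Type*} [AddCommGroup M] [Module A M] [TopologicalSpace M] (ρ : Representation A K M)

/-- An open submodule `N` of a representation of `K` is a level with group `V` if it is stable under
`K` and `V` acts trivially on `M / N`, so that `M / N` is an `A[K/V]`-module. -/
structure IsLevel (N : Submodule A M) (V : OpenNormalSubgroup K) : Prop where
  isOpen : IsOpen (N : Set M)
  le_comap : ∀ k, N ≤ N.comap (ρ k)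
  sub_mem : ∀ k ∈ V, ∀ m, ρ k m - m ∈ N

variable {ρ} {N N' : Submodule A M} {V V' : OpenNormalSubgroup K}

namespace IsLevel

theorem inf (h : IsLevel ρ N V) (h' : IsLevel ρ N' V') : IsLevel ρ (N ⊓ N') (V ⊓ V') where
  isOpen := h.isOpen.inter h'.isOpen
  le_comap k := inf_le_inf (h.le_comap k) (h'.le_comap k)
  sub_mem k hk m := ⟨h.sub_mem k hk.1 m, h'.sub_mem k hk.2 m⟩

/-- The action of `K/V` on the quotient by a level with group `V`. -/
def quotientRep (h : IsLevel ρ N V) : Representation A (K ⧸ V.toSubgroup) (M ⧸ N) :=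
  have : Representation.IsTrivial ((ρ.quotient N h.le_comap).comp V.toSubgroup.subtype) :=
    ⟨fun k => LinearMap.ext fun q => by
      obtain ⟨m, rfl⟩ := N.mkQ_surjective q
      exact (Submodule.Quotient.eq N).2 (h.sub_mem k k.2 m)⟩
  (ρ.quotient N h.le_comap).ofQuotient V.toSubgroup

theorem quotientRep_asAlgebraHom_mapDomain (h : IsLevel ρ N V) (x : MonoidAlgebra A K) (m : M) :
    h.quotientRep.asAlgebraHom
      (MonoidAlgebra.mapDomainRingHom A (QuotientGroup.mk' V.toSubgroup) x) (N.mkQ m) =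
        N.mkQ (ρ.asAlgebraHom x m) := by
  induction x using MonoidAlgebra.induction_linear with
  | zero => simp
  | add x y hx hy => simp only [map_add, LinearMap.add_apply, hx, hy]
  | single k a =>
    simp only [MonoidAlgebra.mapDomainRingHom_apply, MonoidAlgebra.mapDomain_single,
      Representation.asAlgebraHom_single, LinearMap.smul_apply, map_smul]
    rfl

theorem quotientRep_asAlgebraHom_eq_zero (h : IsLevel ρ N V)
    {a : MonoidAlgebra A (K ⧸ V.toSubgroup)} (ha : ∀ q m, a.coeff q • m ∈ N) :
    h.quotientRep.asAlgebraHom a = 0 := by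
  rw [Representation.asAlgebraHom_def, MonoidAlgebra.lift_apply]
  refine Finset.sum_eq_zero fun q _ => LinearMap.ext fun y => ?_
  obtain ⟨m, hm⟩ := N.mkQ_surjective (h.quotientRep q y)
  rw [LinearMap.smul_apply, ← hm, ← map_smul]
  exact (Submodule.Quotient.mk_eq_zero N).2 (ha q m)

theorem quotientRep_asAlgebraHom_eq_of_le (h : IsLevel ρ N V) (h' : IsLevel ρ N' V') (hN : N' ≤ N)
    (hV : V' ≤ V) {l : CompletedGroupAlgebra A K} {m y : M}
    (hy : h'.quotientRep.asAlgebraHom (l.1 V') (N'.mkQ m) = N'.mkQ y) :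
    h.quotientRep.asAlgebraHom (l.1 V) (N.mkQ m) = N.mkQ y := by
  obtain ⟨x, hx⟩ := l.exists_mapDomainRingHom_eq V'
  rw [← hx V' le_rfl, quotientRep_asAlgebraHom_mapDomain] at hy
  rw [← hx V hV, quotientRep_asAlgebraHom_mapDomain]
  exact (Submodule.Quotient.eq N).2 (hN ((Submodule.Quotient.eq N').1 hy))

end IsLevel

variable (ρ) in
/-- The levels of a representation form a basis of neighbourhoods of `0`. -/
def HasLevels : Prop :=
  ∀ s ∈ 𝓝 (0 : M), ∃ (N : Submodule A M) (V : OpenNormalSubgroup K), IsLevel ρ N V ∧ (N : Set M) ⊆ s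

namespace HasLevels

theorem eq_of_forall_mkQ_eq [T2Space M] (h : HasLevels ρ) {y z : M}
    (hyz : ∀ {N : Submodule A M} {V : OpenNormalSubgroup K}, IsLevel ρ N V → N.mkQ y = N.mkQ z) :
    y = z := by
  by_contra hne
  obtain ⟨N, V, hN, hs⟩ := h {y - z}ᶜ
    (isOpen_compl_singleton.mem_nhds (Ne.symm (sub_ne_zero.2 hne)))
  exact hs ((Submodule.Quotient.eq N).1 (hyz hN)) rfl

variable [IsTopologicalAddGroup M] [CompactSpace M]

theorem exists_forall_mkQ_eq (h : HasLevels ρ) (l : CompletedGroupAlgebra A K) (m : M) :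
    ∃ y : M, ∀ {N : Submodule A M} {V : OpenNormalSubgroup K} (hN : IsLevel ρ N V),
      hN.quotientRep.asAlgebraHom (l.1 V) (N.mkQ m) = N.mkQ y := by
  let ι := {p : Submodule A M × OpenNormalSubgroup K // IsLevel ρ p.1 p.2}
  let C (p : ι) : Set M :=
    {y | p.2.quotientRep.asAlgebraHom (l.1 p.1.2) (p.1.1.mkQ m) = p.1.1.mkQ y}
  have hι : Nonempty ι := by
    obtain ⟨N, V, hN, -⟩ := h Set.univ Filter.univ_mem
    exact ⟨⟨(N, V), hN⟩⟩
  have hnonempty (p : ι) : (C p).Nonempty := by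
    obtain ⟨y, hy⟩ := p.1.1.mkQ_surjective
      (p.2.quotientRep.asAlgebraHom (l.1 p.1.2) (p.1.1.mkQ m))
    exact ⟨y, hy.symm⟩
  have hclosed (p : ι) : IsClosed (C p) := by
    obtain ⟨y, hy⟩ := hnonempty p
    convert (AddSubgroup.isClosed_of_isOpen p.1.1.toAddSubgroup p.2.isOpen).preimage
      (continuous_const.sub continuous_id : Continuous fun z => y - z) using 1
    ext z
    change _ = _ ↔ _
    rw [show _ = p.1.1.mkQ y from hy]
    exact Submodule.Quotient.eq _
  have hdirected : Directed (· ⊇ ·) C := fun p q =>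
    ⟨⟨(p.1.1 ⊓ q.1.1, p.1.2 ⊓ q.1.2), p.2.inf q.2⟩,
      fun _ => p.2.quotientRep_asAlgebraHom_eq_of_le _ inf_le_left inf_le_left,
      fun _ => q.2.quotientRep_asAlgebraHom_eq_of_le _ inf_le_right inf_le_right⟩
  obtain ⟨y, hy⟩ := IsCompact.nonempty_iInter_of_directed_nonempty_isCompact_isClosed C hdirected
    hnonempty (fun p => (hclosed p).isCompact) hclosed
  exact ⟨y, fun {N V} hN => Set.mem_iInter.1 hy ⟨(N, V), hN⟩⟩

/-- The action of `A[[K]]` on a compact representation with enough levels, as the limit of the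
actions of `A[K/V]` on the quotients `M / N` by levels. -/
def act (h : HasLevels ρ) (l : CompletedGroupAlgebra A K) (m : M) : M :=
  (h.exists_forall_mkQ_eq l m).choose

theorem mkQ_act (h : HasLevels ρ) (hN : IsLevel ρ N V) (l : CompletedGroupAlgebra A K) (m : M) :
    N.mkQ (h.act l m) = hN.quotientRep.asAlgebraHom (l.1 V) (N.mkQ m) :=
  ((h.exists_forall_mkQ_eq l m).choose_spec hN).symm

theorem act_toCompletedGroupAlgebra [T2Space M] (h : HasLevels ρ) (x : MonoidAlgebra A K) (m : M) :
    h.act (toCompletedGroupAlgebra A K x) m = ρ.asAlgebraHom x m :=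
  h.eq_of_forall_mkQ_eq fun hN =>
    (h.mkQ_act hN _ _).trans (hN.quotientRep_asAlgebraHom_mapDomain x m)

/-- The `A[[K]]`-module structure of a profinite representation with enough levels. -/
abbrev module [T2Space M] (h : HasLevels ρ) : Module (CompletedGroupAlgebra A K) M where
  smul := h.act
  one_smul m := h.eq_of_forall_mkQ_eq fun hN => (h.mkQ_act hN _ _).trans (by simp)
  mul_smul l l' m := h.eq_of_forall_mkQ_eq fun hN => (h.mkQ_act hN _ _).trans (by
    refine .trans ?_ (h.mkQ_act hN l (h.act l' m)).symm
    simp [h.mkQ_act hN])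
  smul_zero l := h.eq_of_forall_mkQ_eq fun hN => (h.mkQ_act hN _ _).trans (by simp)
  smul_add l m m' := h.eq_of_forall_mkQ_eq fun hN => (h.mkQ_act hN _ _).trans (by
    simp only [map_add]
    exact (congrArg₂ (· + ·) (h.mkQ_act hN l m) (h.mkQ_act hN l m')).symm)
  add_smul l l' m := h.eq_of_forall_mkQ_eq fun hN => (h.mkQ_act hN _ _).trans (by
    refine .trans ?_ ((map_add _ _ _).trans
      (congrArg₂ (· + ·) (h.mkQ_act hN l m) (h.mkQ_act hN l' m))).symm
    simp)
  zero_smul m := h.eq_of_forall_mkQ_eq fun hN => (h.mkQ_act hN _ _).trans (by simp)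

theorem continuous_act [TopologicalSpace A] [IsTopologicalRing A] [ContinuousSMul A M]
    [IsTopologicalGroup K] [CompactSpace K] (h : HasLevels ρ) :
    Continuous fun p : CompletedGroupAlgebra A K × M => h.act p.1 p.2 := by
  refine continuous_iff_continuousAt.2 fun ⟨l₀, m₀⟩ => ?_
  rw [ContinuousAt, tendsto_sub_nhds_zero_iff.symm, Filter.tendsto_def]
  intro s hs
  obtain ⟨N, V, hN, hNs⟩ := h s hs
  have hsmul : ∀ᶠ a in 𝓝 (0 : A), ∀ m : M, a • m ∈ N := by
    simpa using isCompact_univ.eventually_forall_of_forall_eventually (x₀ := (0 : A))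
      (P := fun a (m : M) => a • m ∈ N) fun m _ =>
        continuous_smul.continuousAt.eventually_mem (hN.isOpen.mem_nhds (by simp))
  have : Finite (K ⧸ V.toSubgroup) := V.toSubgroup.quotient_finite_of_isOpen V.isOpen'
  have hl : ∀ᶠ l in 𝓝 l₀, ∀ q (m : M), (l.1 V - l₀.1 V).coeff q • m ∈ N :=
    Filter.eventually_all.2 fun q => by
      have hq : Filter.Tendsto (fun l : CompletedGroupAlgebra A K =>
          (l.1 V).coeff q - (l₀.1 V).coeff q) (𝓝 l₀) (𝓝 0) :=
        tendsto_sub_nhds_zero_iff.2 ((CompletedGroupAlgebra.continuous_coeff V q).tendsto l₀)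
      exact hq.eventually hsmul
  have hm : ∀ᶠ m in 𝓝 m₀, m - m₀ ∈ N :=
    (hN.isOpen.preimage (continuous_sub_right m₀)).mem_nhds (by simp)
  rw [nhds_prod_eq]
  filter_upwards [hl.prod_mk hm] with ⟨l, m⟩ ⟨hl, hm⟩
  refine hNs ((Submodule.Quotient.eq N).1 ?_)
  have hmk : N.mkQ m = N.mkQ m₀ := (Submodule.Quotient.eq N).2 hm
  have hlk : hN.quotientRep.asAlgebraHom (l.1 V) = hN.quotientRep.asAlgebraHom (l₀.1 V) :=
    sub_eq_zero.1 ((map_sub _ _ _).symm.trans (hN.quotientRep_asAlgebraHom_eq_zero hl))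
  exact (h.mkQ_act hN l m).trans (by rw [hlk, hmk, ← h.mkQ_act hN]; rfl)

end HasLevels

end CompletedAction

theorem HasLevels.isAugmented {A : Type u} [CommRing A] [TopologicalSpace A] [IsTopologicalRing A]
    {G : Type w} [Group G] [TopologicalSpace G] [IsTopologicalGroup G] {M : TopRep.{v} A G}
    [CompactSpace M] [T2Space M] {K : Subgroup G} (hKo : IsOpen (K : Set G))
    (hKc : IsCompact (K : Set G)) (h : HasLevels (M.ρ.toRepresentation.comp K.subtype)) :
    IsAugmented M :=
  have : CompactSpace K := isCompact_iff_compactSpace.1 hKc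
  ⟨K, hKo, hKc, h.module, h.act_toCompletedGroupAlgebra, h.continuous_act⟩

section ContragredientLevels

theorem exists_isLevel_subset_biInter {A M K ι : Type*} [CommRing A] [AddCommGroup M] [Module A M]
    [TopologicalSpace M] [Group K] [TopologicalSpace K] {ρ : Representation A K M} {S : Set ι}
    (hS : S.Finite) {s : ι → Set M} (hs : ∀ i ∈ S, ∃ (N : Submodule A M)
      (V : OpenNormalSubgroup K), IsLevel ρ N V ∧ (N : Set M) ⊆ s i) :
    ∃ (N : Submodule A M) (V : OpenNormalSubgroup K),
      IsLevel ρ N V ∧ (N : Set M) ⊆ ⋂ i ∈ S, s i := by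
  induction S, hS using Set.Finite.induction_on with
  | empty => exact ⟨⊤, ⟨⊤, Subgroup.normal_top⟩, ⟨isOpen_univ, by simp, by simp⟩, by simp⟩
  | @insert i S _ _ ih =>
    obtain ⟨N, V, hN, hNs⟩ := hs i (Set.mem_insert i S)
    obtain ⟨N', V', hN', hNs'⟩ := ih fun j hj => hs j (Set.mem_insert_of_mem i hj)
    rw [Set.biInter_insert]
    exact ⟨_, _, hN.inf hN', Set.inter_subset_inter hNs hNs'⟩

variable {A : Type u} [CommRing A] [TopologicalSpace A] [IsCompleteNoetherianLocal A]
  {K : Type w} [Group K] [TopologicalSpace K] [IsTopologicalGroup K] [CompactSpace K]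
  [TotallyDisconnectedSpace K] {U : Type v} [AddCommGroup U] [Module A U]
  {ρ : Representation A K U}

theorem exists_isLevel_contragredient {x : U} {n : ℕ}
    (hx : ∀ᶠ k in 𝓝 (1 : K), ρ k x - x ∈ maximalIdeal A ^ n • (⊤ : Submodule A U)) :
    ∃ (N : Submodule A (PointwiseDual A U)) (V : OpenNormalSubgroup K),
      IsLevel (contragredient A K (Rep.of ρ)).toRepresentation N V ∧
        (N : Set (PointwiseDual A U)) ⊆ {f | f x ∈ maximalIdeal A ^ n} := by
  obtain ⟨W, hW, hWo, hW1⟩ := eventually_nhds_iff.1 hx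
  obtain ⟨V, hV⟩ := ProfiniteGrp.exist_openNormalSubgroup_sub_open_nhds_of_one hWo hW1
  have hVx (f : PointwiseDual A U) (k v : K) (hv : v ∈ V) :
      f (ρ (k * v) x) - f (ρ k x) ∈ maximalIdeal A ^ n := by
    have h := apply_mem_of_mem_smul_top ((show Module.Dual A U from f) ∘ₗ ρ k) (hW v (hV hv))
    rw [map_sub] at h
    rw [map_mul]
    exact h
  let N : Submodule A (PointwiseDual A U) :=
    { carrier := {f | ∀ k, f (ρ k x) ∈ maximalIdeal A ^ n}
      add_mem' := fun hf hg k => add_mem (hf k) (hg k)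
      zero_mem' := fun _ => zero_mem _
      smul_mem' := fun a f hf k => Ideal.mul_mem_left _ a (hf k) }
  refine ⟨N, V, ⟨?_, fun k f hf k' => ?_, fun v hv f k => ?_⟩, fun f hf => by simpa using hf 1⟩
  · have : Finite (K ⧸ V.toSubgroup) := V.toSubgroup.quotient_finite_of_isOpen V.isOpen'
    have hN : (N : Set (PointwiseDual A U)) =
        ⋂ q : K ⧸ V.toSubgroup, {f | f (ρ q.out x) ∈ maximalIdeal A ^ n} := by
      ext f
      refine ⟨fun hf => Set.mem_iInter.2 fun q => hf q.out, fun hf k => ?_⟩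
      obtain ⟨v, hv⟩ := QuotientGroup.mk_out_eq_mul V.toSubgroup k
      have h := hVx f k v v.2
      rw [← hv] at h
      exact (Submodule.sub_mem_iff_right _ (Set.mem_iInter.1 hf k)).1 h
    rw [hN]
    exact isOpen_iInter_of_finite fun q =>
      (isOpen_maximalIdeal_pow n).preimage (PointwiseDual.continuous_eval _)
  · change f (ρ k⁻¹ (ρ k' x)) ∈ _
    rw [← Module.End.mul_apply, ← map_mul]
    exact hf _
  · change f (ρ v⁻¹ (ρ k x)) - f (ρ k x) ∈ _
    convert hVx f k _ (V.isNormal'.conj_mem _ (inv_mem hv) k⁻¹) using 2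
    rw [← Module.End.mul_apply, ← map_mul]
    group

theorem hasLevels_contragredient (hρ : ∀ (x : U) (n : ℕ),
      ∀ᶠ k in 𝓝 (1 : K), ρ k x - x ∈ maximalIdeal A ^ n • (⊤ : Submodule A U)) :
    HasLevels (contragredient A K (Rep.of ρ)).toRepresentation := by
  intro s hs
  rw [PointwiseDual.isEmbedding_incl.nhds_eq_comap, nhds_pi] at hs
  obtain ⟨t, ht, hts⟩ := Filter.mem_comap.1 hs
  obtain ⟨S, hS, t', ht', htt⟩ := Filter.mem_pi.1 ht
  choose n _ hn using fun x => hasBasis_nhds_zero.mem_iff.1 (ht' x)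
  obtain ⟨N, V, hN, hNS⟩ :=
    exists_isLevel_subset_biInter hS fun x _ => exists_isLevel_contragredient (hρ x (n x))
  exact ⟨N, V, hN, fun f hf => hts (htt fun x hx => hn x (Set.mem_iInter₂.1 (hNS hf) x hx))⟩

end ContragredientLevels

theorem proAugFl_dual {A : Type u} [CommRing A] [TopologicalSpace A] [IsCompleteNoetherianLocal A]
    {G : Type w} [Group G] [TopologicalSpace G] [IsTopologicalGroup G] [T2Space G]
    [LocallyCompactSpace G] [TotallyDisconnectedSpace G] {π : Rep.{u} A G} (hπ : contFl A G π) :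
    proAugFl A G ((dualFunctor A G).obj (.op π)) := by
  have hprof : IsProfiniteModule A (PointwiseDual A π) := PointwiseDual.isProfiniteModule
  have : CompactSpace ((dualFunctor A G).obj (.op π)) := hprof.compactSpace
  have : T2Space ((dualFunctor A G).obj (.op π)) := hprof.t2Space
  obtain ⟨K, hKo, hKc⟩ := exists_subgroup_isOpen_isCompact G
  have : CompactSpace K := isCompact_iff_compactSpace.1 hKc
  have hlevels : HasLevels ((contragredient A G π).toRepresentation.comp K.subtype) :=
    hasLevels_contragredient (ρ := π.ρ.comp K.subtype) fun x n =>
      (continuous_subtype_val.tendsto (1 : K)).eventually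
        (((isAdicallyContinuous_iff π).1 hπ.1).2 x n)
  have := hπ.2.1
  obtain ⟨I, e, he⟩ := IsOrthonormalBasis.exists_of_forall_free hπ.2.2
  exact ⟨⟨hprof, hlevels.isAugmented hKo hKc⟩, I, ⟨he.dualEquiv⟩⟩

section Duality

/-- An equivariant isomorphism of topological modules, as an isomorphism of topological
representations. -/
def topRepIsoOfEquiv {A : Type u} [CommRing A] [TopologicalSpace A] {G : Type w} [Group G]
    {M N : TopRep.{v} A G} (e : M ≃L[A] N) (he : ∀ g m, e (M.ρ g m) = N.ρ g (e m)) : M ≅ N where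
  hom := TopRep.ofHom (ρ := M.ρ) (σ := N.ρ)
    { (e : M →L[A] N) with isIntertwining' := fun g => ContinuousLinearMap.ext (he g) }
  inv := TopRep.ofHom (ρ := N.ρ) (σ := M.ρ)
    { (e.symm : N →L[A] M) with
      isIntertwining' := fun g => ContinuousLinearMap.ext fun n => e.symm_apply_eq.2
        (.symm ((he g _).trans (congrArg (N.ρ g) (e.apply_symm_apply n)))) }
  hom_inv_id :=
    TopRep.hom_ext (ContIntertwiningMap.ext (ContinuousLinearMap.ext e.symm_apply_apply))
  inv_hom_id :=
    TopRep.hom_ext (ContIntertwiningMap.ext (ContinuousLinearMap.ext e.apply_symm_apply))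

theorem isIso_topRepHom_of_bijective {A : Type u} [CommRing A] [TopologicalSpace A] {G : Type w}
    [Group G] {M N : TopRep.{v} A G} [CompactSpace M] [T2Space N] (f : M ⟶ N)
    (hf : Function.Bijective f.hom) : IsIso f :=
  (topRepIsoOfEquiv (continuousLinearEquivOfBijective f.hom.toContinuousLinearMap hf) fun g m =>
    TopRep.hom_comm_apply f g m).isIso_hom

variable {A : Type u} [CommRing A] [TopologicalSpace A] [IsCompleteNoetherianLocal A]
  {G : Type w} [Group G]

theorem isIso_evalRep {π : Rep.{u} A G} (hπ : IsOrthonormalizable A π) :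
    IsIso (evalRep A G π) := by
  have := hπ.1
  obtain ⟨I, e, he⟩ := IsOrthonormalBasis.exists_of_forall_free hπ.2
  exact (ConcreteCategory.isIso_iff_bijective _).2 he.bijective_bidualEval

theorem isIso_evalTopRep {M : TopRep.{u} A G} (hprof : IsProfiniteModule A M)
    (hfree : IsTopologicallyFree A M) : IsIso (evalTopRep A G M) := by
  obtain ⟨I, ⟨ν⟩⟩ := hfree
  have := hprof.compactSpace
  have : T2Space ((dualFunctor A G).obj (.op ((contDualFunctor A G).obj (.op M)))) :=
    PointwiseDual.isProfiniteModule.t2Space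
  exact isIso_topRepHom_of_bijective _ (bijective_contBidualEval ν)

variable (A G) [TopologicalSpace G] [IsTopologicalGroup G] [T2Space G] [LocallyCompactSpace G]
  [TotallyDisconnectedSpace G]

/-- The anti-equivalence between orthonormalizable `𝔪`-adically continuous representations and
topologically free profinite augmented ones. -/
def dualityEquivalence : (contFl.{u} A G).FullSubcategory ≌ (proAugFl.{u} A G).FullSubcategoryᵒᵖ :=
  .mk (dualFl A G fun _ => proAugFl_dual).rightOp (contDualFl A G fun _ => contFl_contDual)
    (NatIso.ofComponents (fun X => (contFl A G).isoMk
      (@asIso _ _ _ _ (evalRep A G X.obj) (isIso_evalRep X.property.2))) fun _ => rfl)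
    (NatIso.ofComponents (fun X => ((proAugFl A G).isoMk
      (@asIso _ _ _ _ (evalTopRep A G X.unop.obj)
        (isIso_evalTopRep X.unop.property.1.1 X.unop.property.2))).op) fun _ => rfl)

theorem isEquivalence_dualFl : (dualFl A G fun _ => proAugFl_dual).IsEquivalence :=
  have := (dualityEquivalence A G).isEquivalence_functor
  inferInstanceAs (dualityEquivalence A G).functor.leftOp.IsEquivalence

theorem isEquivalence_contDualFl : (contDualFl A G fun _ => contFl_contDual).IsEquivalence :=
  (dualityEquivalence A G).isEquivalence_inverse

end Duality

section AdicBaseChange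

section Levels

variable {A : Type u} [CommRing A] (A' : Type u) [CommRing A'] [Algebra A A'] (U : Type v)
  [AddCommGroup U] [Module A U]

/-- The identification of `(A' ⊗_A U)/J(A' ⊗_A U)` with `A'/J ⊗_A U`. -/
def quotTensorEquiv (J : Ideal A') :
    ((A' ⊗[A] U) ⧸ (J • ⊤ : Submodule A' (A' ⊗[A] U))) ≃ₗ[A'] (A' ⧸ J) ⊗[A] U :=
  (quotTensorEquivQuotSMul (A' ⊗[A] U) J).symm.trans
    (AlgebraTensorModule.cancelBaseChange A A' A' (A' ⧸ J) U)

variable {U}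

@[simp]
theorem quotTensorEquiv_mk_tmul (J : Ideal A') (b : A') (x : U) :
    quotTensorEquiv A' U J (Submodule.Quotient.mk (b ⊗ₜ[A] x)) = Ideal.Quotient.mk J b ⊗ₜ x := by
  refine (AlgebraTensorModule.cancelBaseChange_tmul A A' A' (1 : A' ⧸ J) x b).trans ?_
  rw [Algebra.smul_def, mul_one, Ideal.Quotient.algebraMap_eq]

theorem quotTensorEquiv_factor {J J' : Ideal A'} (h : J ≤ J')
    (z : (A' ⊗[A] U) ⧸ (J • ⊤ : Submodule A' (A' ⊗[A] U))) :
    quotTensorEquiv A' U J' (Submodule.factor (Submodule.smul_mono_left h) z) =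
      quotTensorMap h (LinearMap.id : U →ₗ[A] U) (quotTensorEquiv A' U J z) := by
  obtain ⟨z, rfl⟩ := Submodule.Quotient.mk_surjective _ z
  induction z using TensorProduct.induction_on with
  | zero => simp
  | add y z hy hz => simp only [Submodule.Quotient.mk_add, map_add, hy, hz]
  | tmul b x => rw [quotTensorEquiv_mk_tmul]; exact quotTensorEquiv_mk_tmul A' J' b x

variable (A U) [IsLocalRing A']

/-- The completed tensor product is the completion of the tensor product. -/
def adicBaseChangeEquiv :
    AdicCompletion (maximalIdeal A') (A' ⊗[A] U) ≃ₗ[A'] adicBaseChange A A' U where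
  toFun x := ⟨fun n => quotTensorEquiv A' U _ (x.val n), fun m n h => by
    beta_reduce
    rw [← x.2 h]
    exact (quotTensorEquiv_factor A' (Ideal.pow_le_pow_right h) _).symm⟩
  map_add' x y := by ext n; simp
  map_smul' a x := by
    ext n
    exact (quotTensorEquiv A' U _).map_smul a (x.val n)
  invFun y := ⟨fun n => (quotTensorEquiv A' U _).symm (y.1 n), fun {m n} h => by
    rw [LinearEquiv.eq_symm_apply]
    refine (quotTensorEquiv_factor A' (Ideal.pow_le_pow_right h) _).trans ?_
    rw [LinearEquiv.apply_symm_apply]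
    exact y.2 m n h⟩
  left_inv x := by ext n; simp
  right_inv y := by ext n; simp

variable {A U}

/-- The canonical map from the tensor product to the completed tensor product. -/
def toAdicBaseChange : A' ⊗[A] U →ₗ[A'] adicBaseChange A A' U :=
  (adicBaseChangeEquiv A A' U).toLinearMap ∘ₗ AdicCompletion.of (maximalIdeal A') (A' ⊗[A] U)

theorem toAdicBaseChange_tmul (b : A') (x : U) :
    toAdicBaseChange A' (b ⊗ₜ[A] x) =
      ⟨fun _ => Ideal.Quotient.mk _ b ⊗ₜ x, fun _ _ _ => rfl⟩ :=
  Subtype.ext <| funext fun n => quotTensorEquiv_mk_tmul A' (maximalIdeal A' ^ n) b x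

theorem adicBaseChangeMap_toAdicBaseChange {V : Type v} [AddCommGroup V] [Module A V]
    (φ : U →ₗ[A] V) (z : A' ⊗[A] U) :
    adicBaseChangeMap A' φ (toAdicBaseChange A' z) = toAdicBaseChange A' (φ.baseChange A' z) := by
  induction z using TensorProduct.induction_on with
  | zero => simp
  | add y z hy hz => simp only [map_add, hy, hz]
  | tmul b x => rw [toAdicBaseChange_tmul, LinearMap.baseChange_tmul, toAdicBaseChange_tmul]; rfl

end Levels

section IsNoetherianRing

variable {A : Type u} [CommRing A] {A' : Type u} [CommRing A'] [Algebra A A'] [IsLocalRing A']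
  [IsNoetherianRing A'] {U : Type v} [AddCommGroup U] [Module A U]

instance : IsAdicComplete (maximalIdeal A') (adicBaseChange A A' U) :=
  have := AdicCompletion.isAdicComplete (M := A' ⊗[A] U)
    (maximalIdeal A').fg_of_isNoetherianRing
  isAdicComplete_of_equiv (adicBaseChangeEquiv A A' U)

theorem mem_pow_smul_top_adicBaseChange_iff {n : ℕ} {y : adicBaseChange A A' U} :
    y ∈ maximalIdeal A' ^ n • (⊤ : Submodule A' (adicBaseChange A A' U)) ↔ y.1 n = 0 := by
  obtain ⟨x, rfl⟩ := (adicBaseChangeEquiv A A' U).surjective y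
  rw [equiv_apply_mem_smul_top_iff (V := adicBaseChange A A' U),
    AdicCompletion.pow_smul_top_eq_ker_eval (maximalIdeal A').fg_of_isNoetherianRing,
    LinearMap.mem_ker]
  exact (LinearEquiv.map_eq_zero_iff (quotTensorEquiv A' U (maximalIdeal A' ^ n))).symm

end IsNoetherianRing

section Local

variable {A : Type u} [CommRing A] [IsLocalRing A] (A' : Type u) [CommRing A'] [Algebra A A']
  [IsLocalRing A'] [IsLocalHom (algebraMap A A')] {U : Type v} [AddCommGroup U] [Module A U]

theorem maximalIdeal_le_comap_algebraMap :
    maximalIdeal A ≤ (maximalIdeal A').comap (algebraMap A A') :=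
  ((IsLocalRing.local_hom_TFAE (algebraMap A A')).out 0 3).1 ‹_›

theorem maximalIdeal_pow_le_comap_algebraMap (n : ℕ) :
    maximalIdeal A ^ n ≤ (maximalIdeal A' ^ n).comap (algebraMap A A') :=
  (Ideal.pow_right_mono (maximalIdeal_le_comap_algebraMap A') n).trans (Ideal.le_comap_pow _ n)

theorem mk_tmul_eq_zero {n : ℕ} (b : A' ⧸ maximalIdeal A' ^ n) {x : U}
    (hx : x ∈ maximalIdeal A ^ n • (⊤ : Submodule A U)) : b ⊗ₜ[A] x = 0 := by
  obtain ⟨b, rfl⟩ := Ideal.Quotient.mk_surjective b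
  rw [← quotTensorEquiv_mk_tmul, (Submodule.Quotient.mk_eq_zero _).2
    (tmul_mem_smul_top (maximalIdeal_pow_le_comap_algebraMap A' n) b hx), map_zero]

variable [IsNoetherianRing A']

theorem IsOrthonormalBasis.toAdicBaseChange_one_tmul {I : Type*} {e : I → U}
    (he : IsOrthonormalBasis (maximalIdeal A) e) :
    IsOrthonormalBasis (maximalIdeal A') fun i => toAdicBaseChange A' ((1 : A') ⊗ₜ[A] e i) := by
  have hcompletion := (he.baseChange (maximalIdeal_le_comap_algebraMap A')).adicCompletion_of
    (maximalIdeal A').fg_of_isNoetherianRing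
  exact hcompletion.map_equiv (V := adicBaseChange A A' U) (adicBaseChangeEquiv A A' U)

theorem isOrthonormalizable_adicBaseChange (hU : IsOrthonormalizable A U) :
    IsOrthonormalizable A' (adicBaseChange A A' U) := by
  obtain ⟨I, e, he⟩ := IsOrthonormalBasis.exists_of_forall_free hU.2
  exact ⟨inferInstance, (he.toAdicBaseChange_one_tmul A').free⟩

end Local

theorem eventually_quotTensorMap_eq {A : Type u} [CommRing A] [IsLocalRing A] {A' : Type u}
    [CommRing A'] [Algebra A A'] [IsLocalRing A'] [IsLocalHom (algebraMap A A')] {G U : Type*}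
    [Group G] [TopologicalSpace G] [AddCommGroup U] [Module A U] (ρ : Representation A G U)
    {n : ℕ} (hρ : ∀ x, ∀ᶠ g in 𝓝 (1 : G), ρ g x - x ∈ maximalIdeal A ^ n • (⊤ : Submodule A U))
    (z : (A' ⧸ maximalIdeal A' ^ n) ⊗[A] U) :
    ∀ᶠ g in 𝓝 (1 : G), quotTensorMap le_rfl (ρ g) z = z := by
  induction z using TensorProduct.induction_on with
  | zero => simp
  | add y z hy hz =>
    filter_upwards [hy, hz] with g hgy hgz
    rw [map_add, hgy, hgz]
  | tmul b x =>
    filter_upwards [hρ x] with g hg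
    have h := mk_tmul_eq_zero A' b hg
    rw [tmul_sub, sub_eq_zero] at h
    obtain ⟨b, rfl⟩ := Ideal.Quotient.mk_surjective b
    exact h

theorem contFl_adicBaseChange {A : Type u} [CommRing A] [TopologicalSpace A]
    [IsCompleteNoetherianLocal A] {A' : Type u} [CommRing A'] [TopologicalSpace A']
    [IsCompleteNoetherianLocal A'] [Algebra A A'] [IsLocalHom (algebraMap A A')] {G : Type w}
    [Group G] [TopologicalSpace G] [IsTopologicalGroup G] {π : Rep.{u} A G}
    (hπ : contFl A G π) : contFl A' G ((adicBaseChangeFunctor A' G).obj π) := by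
  have hfree := isOrthonormalizable_adicBaseChange A' hπ.2
  refine ⟨(isAdicallyContinuous_iff _).2 ⟨hfree.1, fun y n => ?_⟩, hfree⟩
  filter_upwards [eventually_quotTensorMap_eq π.ρ
    (fun x => ((isAdicallyContinuous_iff π).1 hπ.1).2 x n) (y.1 n)] with g hg
  exact mem_pow_smul_top_adicBaseChange_iff.2 (sub_eq_zero.2 hg)

end AdicBaseChange

section ProBaseChange

section General

variable {A : Type u} [CommRing A] {A' : Type u} [CommRing A'] [TopologicalSpace A'] [Algebra A A']
  {M : Type v} [AddCommGroup M] [Module A M] [TopologicalSpace M]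

/-- The element `m ⊗ b` of the completed tensor product `M ⊗̂ A'`. -/
def proPure (m : M) (b : A') : proBaseChange A A' M :=
  ⟨fun _ => Ideal.Quotient.mk _ b ⊗ₜ Submodule.Quotient.mk m, fun _ _ _ _ => rfl⟩

theorem hasBasis_nhds_proBaseChange (x : proBaseChange A A' M) :
    (𝓝 x).HasBasis (fun _ : OpenPair A A' M => True) fun p => {y | y.1 p = x.1 p} := by
  have hnhds : 𝓝 x = ⨅ p : OpenPair A A' M, Filter.principal {y | y.1 p = x.1 p} := by
    rw [nhds_iInf]
    refine iInf_congr fun p => ?_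
    let : TopologicalSpace ((A' ⧸ p.2.1) ⊗[A] (M ⧸ p.1.1)) := ⊥
    have : DiscreteTopology ((A' ⧸ p.2.1) ⊗[A] (M ⧸ p.1.1)) := ⟨rfl⟩
    rw [nhds_induced, nhds_discrete, Filter.comap_pure]
    rfl
  have : Nonempty (OpenPair A A' M) := ⟨(⟨⊤, isOpen_univ⟩, ⟨⊤, isOpen_univ⟩)⟩
  rw [hnhds]
  refine Filter.hasBasis_iInf_principal fun p q => ?_
  let r : OpenPair A A' M :=
    (⟨p.1.1 ⊓ q.1.1, p.1.2.inter q.1.2⟩, ⟨p.2.1 ⊓ q.2.1, p.2.2.inter q.2.2⟩)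
  have hle {t : OpenPair A A' M} (h₁ : r.1.1 ≤ t.1.1) (h₂ : r.2.1 ≤ t.2.1) :
      {y : proBaseChange A A' M | y.1 r = x.1 r} ⊆ {y | y.1 t = x.1 t} := fun y hy => by
    change y.1 t = x.1 t
    rw [← y.2 r t h₁ h₂, ← x.2 r t h₁ h₂]
    exact congrArg _ hy
  exact ⟨r, hle inf_le_left inf_le_left, hle inf_le_right inf_le_right⟩

instance : T2Space (proBaseChange A A' M) := by
  refine ⟨fun x y hxy => ?_⟩
  obtain ⟨p, hp⟩ := Function.ne_iff.1 (Subtype.coe_ne_coe.2 hxy)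
  let : TopologicalSpace ((A' ⧸ p.2.1) ⊗[A] (M ⧸ p.1.1)) := ⊥
  have : DiscreteTopology ((A' ⧸ p.2.1) ⊗[A] (M ⧸ p.1.1)) := ⟨rfl⟩
  exact separated_by_continuous (continuous_proBaseChangeProj A A' M p) hp

theorem dense_span_proPure :
    Dense (Submodule.span A' (Set.range fun mb : M × A' => proPure (A := A) mb.1 mb.2) :
      Set (proBaseChange A A' M)) := by
  intro x
  rw [mem_closure_iff_nhds_basis (hasBasis_nhds_proBaseChange x)]
  intro p _
  suffices hproj : ⊤ ≤ (Submodule.span A' _).map (proBaseChangeProj A A' M p) by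
    obtain ⟨z, hz, hzx⟩ := hproj (show x.1 p ∈ ⊤ from trivial)
    exact ⟨z, hz, hzx⟩
  rintro t -
  induction t using TensorProduct.induction_on with
  | zero => exact zero_mem _
  | add s t hs ht => exact add_mem hs ht
  | tmul b m =>
    obtain ⟨b, rfl⟩ := Ideal.Quotient.mk_surjective b
    obtain ⟨m, rfl⟩ := Submodule.Quotient.mk_surjective _ m
    exact ⟨_, Submodule.subset_span ⟨(m, b), rfl⟩, rfl⟩

theorem proBaseChange_hom_ext {P : Type*} [AddCommGroup P] [Module A' P] [TopologicalSpace P]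
    [T2Space P] {f g : proBaseChange A A' M →L[A'] P}
    (h : ∀ m b, f (proPure m b) = g (proPure m b)) : f = g := by
  refine ContinuousLinearMap.ext_on dense_span_proPure ?_
  rintro _ ⟨⟨m, b⟩, rfl⟩
  exact h m b

/-- The isomorphism of completed tensor products induced by an isomorphism of topological
modules. -/
def proBaseChangeCongr [TopologicalSpace A] (A' : Type u) [CommRing A'] [TopologicalSpace A']
    [Algebra A A'] {N : Type v} [AddCommGroup N] [Module A N] [TopologicalSpace N]
    (e : M ≃L[A] N) : proBaseChange A A' M ≃L[A'] proBaseChange A A' N :=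
  .equivOfInverse (proBaseChangeMap A' (e : M →L[A] N)) (proBaseChangeMap A' (e.symm : N →L[A] M))
    (fun x => by
      rw [← ContinuousLinearMap.comp_apply, ← proBaseChangeMap_comp,
        ContinuousLinearEquiv.coe_symm_comp_coe, proBaseChangeMap_id]
      rfl)
    (fun x => by
      rw [← ContinuousLinearMap.comp_apply, ← proBaseChangeMap_comp,
        ContinuousLinearEquiv.coe_comp_coe_symm, proBaseChangeMap_id]
      rfl)

end General

section Pi

theorem exists_finset_forall_mem_of_isOpen {A I : Type*} [Semiring A] [TopologicalSpace A]
    {N : Submodule A (I → A)} (hN : IsOpen (N : Set (I → A))) :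
    ∃ s : Finset I, ∀ g : I → A, (∀ i ∈ s, g i = 0) → g ∈ N := by
  have hnhds := hN.mem_nhds (zero_mem N)
  rw [nhds_pi, Filter.mem_pi] at hnhds
  obtain ⟨s, hs, t, ht, hst⟩ := hnhds
  refine ⟨hs.toFinset, fun g hg => hst fun i hi => ?_⟩
  rw [hg i (hs.mem_toFinset.2 hi)]
  exact mem_of_mem_nhds (ht i)

theorem single_mem_of_notMem {A I : Type*} [Semiring A] [DecidableEq I]
    {N : Submodule A (I → A)} {s : Finset I} (hs : ∀ g : I → A, (∀ i ∈ s, g i = 0) → g ∈ N)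
    {i : I} (hi : i ∉ s) (a : A) : Pi.single i a ∈ N :=
  hs _ fun _ hj => Pi.single_eq_of_ne (ne_of_mem_of_not_mem hj hi) _

variable {A : Type u} [CommRing A] [TopologicalSpace A] {A' : Type u} [CommRing A']
  [TopologicalSpace A'] [Algebra A A'] {I : Type v} [DecidableEq I]

theorem finsum_mk_tmul_mk_single (p : OpenPair A A' (I → A)) {s : Finset I}
    (hs : ∀ i ∉ s, (Pi.single i 1 : I → A) ∈ p.1.1) (c : I → A') :
    ∑ᶠ i, Ideal.Quotient.mk p.2.1 (c i) ⊗ₜ[A]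
        (Submodule.Quotient.mk (Pi.single i 1) : (I → A) ⧸ p.1.1) =
      ∑ i ∈ s, Ideal.Quotient.mk p.2.1 (c i) ⊗ₜ[A]
        (Submodule.Quotient.mk (Pi.single i 1) : (I → A) ⧸ p.1.1) := by
  refine finsum_eq_sum_of_support_subset _ fun i hi => ?_
  by_contra his
  refine hi ?_
  beta_reduce
  rw [(Submodule.Quotient.mk_eq_zero _).2 (hs i his), tmul_zero]

/-- The component at `p` of the map `A'^I → A^I ⊗̂ A'`. -/
def piToProComponent (p : OpenPair A A' (I → A)) :
    (I → A') →ₗ[A'] (A' ⧸ p.2.1) ⊗[A] ((I → A) ⧸ p.1.1) where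
  toFun c := ∑ᶠ i, Ideal.Quotient.mk p.2.1 (c i) ⊗ₜ[A] Submodule.Quotient.mk (Pi.single i 1)
  map_add' c d := by
    obtain ⟨s, hs⟩ := exists_finset_forall_mem_of_isOpen p.1.2
    have hsum := finsum_mk_tmul_mk_single (A' := A') p fun i hi => single_mem_of_notMem hs hi 1
    rw [hsum, hsum, hsum, ← Finset.sum_add_distrib]
    simp only [Pi.add_apply, map_add, add_tmul]
  map_smul' a c := by
    obtain ⟨s, hs⟩ := exists_finset_forall_mem_of_isOpen p.1.2
    have hsum := finsum_mk_tmul_mk_single (A' := A') p fun i hi => single_mem_of_notMem hs hi 1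
    rw [hsum, hsum, Finset.smul_sum]
    rfl

theorem piToProComponent_apply (p : OpenPair A A' (I → A)) {s : Finset I}
    (hs : ∀ i ∉ s, (Pi.single i 1 : I → A) ∈ p.1.1) (c : I → A') :
    piToProComponent p c = ∑ i ∈ s, Ideal.Quotient.mk p.2.1 (c i) ⊗ₜ[A]
      (Submodule.Quotient.mk (Pi.single i 1) : (I → A) ⧸ p.1.1) :=
  finsum_mk_tmul_mk_single p hs c

variable [IsTopologicalRing A']

variable (A A' I) in
/-- The map `A'^I → A^I ⊗̂ A'` sending `c` to the sum of the elements `eᵢ ⊗ cᵢ`, where `eᵢ` are the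
standard basis vectors of `A^I`. Only finitely many `eᵢ` are nonzero modulo a given open submodule,
so that this sum converges. -/
def piToPro : (I → A') →L[A'] proBaseChange A A' (I → A) where
  toFun c := ⟨fun p => piToProComponent p c, fun p q h₁ h₂ => by
    obtain ⟨s, hs⟩ := exists_finset_forall_mem_of_isOpen p.1.2
    have hsp (i : I) (hi : i ∉ s) := single_mem_of_notMem hs hi 1
    beta_reduce
    rw [piToProComponent_apply p hsp, piToProComponent_apply q fun i hi => h₁ (hsp i hi), map_sum]
    rfl⟩
  map_add' c d := Subtype.ext <| funext fun p => map_add (piToProComponent p) c d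
  map_smul' a c := Subtype.ext <| funext fun p => map_smul (piToProComponent p) a c
  cont := continuous_iInf_rng.2 fun p => continuous_induced_rng.2 <| by
    let : TopologicalSpace ((A' ⧸ p.2.1) ⊗[A] ((I → A) ⧸ p.1.1)) := ⊥
    have : DiscreteTopology ((A' ⧸ p.2.1) ⊗[A] ((I → A) ⧸ p.1.1)) := ⟨rfl⟩
    obtain ⟨s, hs⟩ := exists_finset_forall_mem_of_isOpen p.1.2
    refine continuous_of_continuousAt_zero (piToProComponent p)
      (tendsto_nhds_of_eventually_eq ?_)
    have hmem : ∀ᶠ c : I → A' in 𝓝 0, ∀ i ∈ s, c i ∈ p.2.1 :=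
      (Filter.eventually_all_finset s).2 fun i _ =>
        (p.2.2.preimage (continuous_apply i)).mem_nhds (zero_mem p.2.1)
    filter_upwards [hmem] with c hc
    rw [map_zero, piToProComponent_apply p fun i hi => single_mem_of_notMem hs hi 1]
    exact Finset.sum_eq_zero fun i hi => by
      rw [Ideal.Quotient.eq_zero_iff_mem.2 (hc i hi), zero_tmul]

theorem piToPro_mul_algebraMap (f : I → A) (a : A') :
    piToPro A A' I (fun i => a * algebraMap A A' (f i)) = proPure f a := by
  refine Subtype.ext (funext fun p => ?_)
  obtain ⟨s, hs⟩ := exists_finset_forall_mem_of_isOpen p.1.2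
  refine (piToProComponent_apply p (fun i hi => single_mem_of_notMem hs hi 1) _).trans ?_
  have hf : (Submodule.Quotient.mk f : (I → A) ⧸ p.1.1) =
      ∑ i ∈ s, f i • Submodule.Quotient.mk (Pi.single i 1) := by
    have hsub : f - ∑ i ∈ s, f i • (Pi.single i 1 : I → A) ∈ p.1.1 := hs _ fun i hi => by
      simp [Finset.sum_apply, Pi.single_apply, hi]
    rw [(Submodule.Quotient.eq p.1.1).2 hsub, ← Submodule.mkQ_apply, map_sum]
    rfl
  change _ = Ideal.Quotient.mk p.2.1 a ⊗ₜ (Submodule.Quotient.mk f : (I → A) ⧸ p.1.1)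
  rw [hf, tmul_sum]
  refine Finset.sum_congr rfl fun i _ => ?_
  rw [← TensorProduct.smul_tmul, mul_comm, ← Algebra.smul_def]
  rfl

theorem surjective_piToPro [CompactSpace A'] : Function.Surjective (piToPro A A' I) := by
  have hclosed : IsClosed (Set.range (piToPro A A' I)) :=
    (isCompact_range (piToPro A A' I).continuous).isClosed
  have hle : Submodule.span A' (Set.range fun fa : (I → A) × A' => proPure fa.1 fa.2) ≤
      LinearMap.range (piToPro A A' I).toLinearMap := by
    rw [Submodule.span_le]
    rintro _ ⟨⟨f, a⟩, rfl⟩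
    exact ⟨_, piToPro_mul_algebraMap f a⟩
  have hdense : DenseRange (piToPro A A' I) := dense_span_proPure.mono hle
  exact Set.range_eq_univ.1 (hclosed.closure_eq ▸ hdense.closure_eq)

theorem mem_of_piToPro_eq_zero (hcont : Continuous (algebraMap A A')) {c : I → A'}
    (hc : piToPro A A' I c = 0) {𝔞 : Ideal A'} (h𝔞 : IsOpen (𝔞 : Set A')) (i : I) : c i ∈ 𝔞 := by
  let N : Submodule A (I → A) := Submodule.comap (LinearMap.proj i) (𝔞.comap (algebraMap A A'))
  let p : OpenPair A A' (I → A) :=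
    (⟨N, h𝔞.preimage (hcont.comp (continuous_apply i))⟩, ⟨𝔞, h𝔞⟩)
  let coord : (A' ⧸ 𝔞) ⊗[A] ((I → A) ⧸ N) →ₗ[A] A' ⧸ 𝔞 :=
    LinearMap.mul' A (A' ⧸ 𝔞) ∘ₗ TensorProduct.map LinearMap.id
      (N.liftQ (Algebra.linearMap A (A' ⧸ 𝔞) ∘ₗ LinearMap.proj i) fun _ =>
        Ideal.Quotient.eq_zero_iff_mem.2)
  have hsingle (j : I) (hj : j ∉ ({i} : Finset I)) : (Pi.single j 1 : I → A) ∈ N := by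
    rw [Finset.mem_singleton] at hj
    simp [N, Pi.single_eq_of_ne (Ne.symm hj)]
  have hp : piToProComponent p c = 0 := congrArg (fun x : proBaseChange A A' (I → A) => x.1 p) hc
  rw [piToProComponent_apply p hsingle, Finset.sum_singleton] at hp
  have hcoord : coord (Ideal.Quotient.mk 𝔞 (c i) ⊗ₜ Submodule.Quotient.mk (Pi.single i 1)) =
      Ideal.Quotient.mk 𝔞 (c i) := by
    change Ideal.Quotient.mk 𝔞 (c i) * algebraMap A (A' ⧸ 𝔞) ((Pi.single i 1 : I → A) i) = _
    rw [Pi.single_eq_same, map_one, mul_one]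
  exact Ideal.Quotient.eq_zero_iff_mem.1
    (hcoord.symm.trans ((congrArg coord hp).trans (map_zero coord)))

theorem injective_piToPro [IsLinearTopology A' A'] [T2Space A']
    (hcont : Continuous (algebraMap A A')) : Function.Injective (piToPro A A' I) := by
  refine (injective_iff_map_eq_zero _).2 fun c hc => funext fun i => ?_
  by_contra hi
  obtain ⟨𝔞, h𝔞, hsub⟩ := IsLinearTopology.hasBasis_open_ideal.mem_iff.1
    (isOpen_compl_singleton.mem_nhds (Ne.symm hi))
  exact hsub (mem_of_piToPro_eq_zero hcont hc h𝔞 i) rfl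

variable [CompactSpace A'] [IsLinearTopology A' A'] [T2Space A']
  (hcont : Continuous (algebraMap A A'))

variable (I) in
/-- The completed tensor product of a product of copies of `A` is the product of as many copies
of `A'`. -/
def piProEquiv : (I → A') ≃L[A'] proBaseChange A A' (I → A) :=
  continuousLinearEquivOfBijective (piToPro A A' I)
    ⟨injective_piToPro hcont, surjective_piToPro⟩

theorem piProEquiv_symm_proPure (f : I → A) (a : A') :
    (piProEquiv I hcont).symm (proPure f a) = fun i => a * algebraMap A A' (f i) :=
  (ContinuousLinearEquiv.symm_apply_eq _).2 (piToPro_mul_algebraMap f a).symm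

end Pi

end ProBaseChange

section DualBaseChange

variable {A : Type u} [CommRing A] [TopologicalSpace A] [IsCompleteNoetherianLocal A]
  {A' : Type u} [CommRing A'] [TopologicalSpace A'] [IsCompleteNoetherianLocal A']
  [Algebra A A'] [IsLocalHom (algebraMap A A')]

theorem continuous_algebraMap_of_isLocalHom : Continuous (algebraMap A A') := by
  refine continuous_of_continuousAt_zero (algebraMap A A') ?_
  rw [ContinuousAt, map_zero, hasBasis_nhds_zero.tendsto_iff hasBasis_nhds_zero]
  exact fun n _ => ⟨n, trivial, maximalIdeal_pow_le_comap_algebraMap A' n⟩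

variable {U : Type v} [AddCommGroup U] [Module A U]

theorem IsOrthonormalizable.adicBaseChange_hom_ext (hU : IsOrthonormalizable A U)
    {f g : adicBaseChange A A' U →ₗ[A'] A'}
    (h : ∀ x : U, f (toAdicBaseChange A' (1 ⊗ₜ x)) = g (toAdicBaseChange A' (1 ⊗ₜ x))) :
    f = g := by
  obtain ⟨I, e, he⟩ := IsOrthonormalBasis.exists_of_forall_free hU.2
  exact (he.toAdicBaseChange_one_tmul A').hom_ext fun i => h (e i)

namespace IsOrthonormalBasis

variable [IsAdicComplete (maximalIdeal A) U] {I : Type v} [DecidableEq I] {e : I → U}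
  (he : IsOrthonormalBasis (maximalIdeal A) e)

variable (A') in
/-- The isomorphism `Hom_A(U, A) ⊗̂ A' ≅ Hom_{A'}(U ⊗̂ A', A')` in which both sides are identified
with `A'^I` by means of an orthonormal basis. -/
def dualBaseChangeEquiv :
    proBaseChange A A' (PointwiseDual A U) ≃L[A'] PointwiseDual A' (adicBaseChange A A' U) :=
  ((proBaseChangeCongr A' he.dualEquiv).trans
    (piProEquiv I continuous_algebraMap_of_isLocalHom).symm).trans
    (he.toAdicBaseChange_one_tmul A').dualEquiv.symm

theorem dualBaseChangeEquiv_proPure (f : PointwiseDual A U) (a b : A') (x : U) :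
    he.dualBaseChangeEquiv A' (proPure f a) (toAdicBaseChange A' (b ⊗ₜ x)) =
      a * b * algebraMap A A' (f x) := by
  let F : adicBaseChange A A' U →ₗ[A'] A' := he.dualBaseChangeEquiv A' (proPure f a)
  let L : A' ⊗[A] U →ₗ[A'] A' := a • (Algebra.linearMap A A' ∘ₗ (f : U →ₗ[A] A)).liftBaseChange A'
  have hL (b : A') (x : U) : L (b ⊗ₜ x) = a * b * algebraMap A A' (f x) := (mul_assoc _ _ _).symm
  suffices hFL : F ∘ₗ toAdicBaseChange A' = L from
    (LinearMap.congr_fun hFL (b ⊗ₜ x)).trans (hL b x)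
  refine (he.baseChange (maximalIdeal_le_comap_algebraMap A')).hom_ext fun i => ?_
  have hF : F (toAdicBaseChange A' (1 ⊗ₜ e i)) =
      (piProEquiv I continuous_algebraMap_of_isLocalHom).symm (proPure (he.dualEquiv f) a) i :=
    congrFun ((he.toAdicBaseChange_one_tmul A').dualEquiv.apply_symm_apply _) i
  refine hF.trans ?_
  rw [piProEquiv_symm_proPure, hL, mul_one]
  rfl

end IsOrthonormalBasis

namespace IsOrthonormalizable

variable (A') in
theorem exists_dualBaseChangeEquiv (hU : IsOrthonormalizable A U) :
    ∃ Φ : proBaseChange A A' (PointwiseDual A U) ≃L[A'] PointwiseDual A' (adicBaseChange A A' U),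
      ∀ f a b x,
        Φ (proPure f a) (toAdicBaseChange A' (b ⊗ₜ x)) = a * b * algebraMap A A' (f x) := by
  classical
  have := hU.1
  obtain ⟨I, e, he⟩ := IsOrthonormalBasis.exists_of_forall_free hU.2
  exact ⟨he.dualBaseChangeEquiv A', he.dualBaseChangeEquiv_proPure⟩

/-- The isomorphism `Hom_A(U, A) ⊗̂ A' ≅ Hom_{A'}(U ⊗̂ A', A')`, characterized by
`dualBaseChangeEquiv_proPure`. -/
def dualBaseChangeEquiv (hU : IsOrthonormalizable A U) :
    proBaseChange A A' (PointwiseDual A U) ≃L[A'] PointwiseDual A' (adicBaseChange A A' U) :=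
  (hU.exists_dualBaseChangeEquiv A').choose

theorem dualBaseChangeEquiv_proPure (hU : IsOrthonormalizable A U) (f : PointwiseDual A U)
    (a b : A') (x : U) :
    hU.dualBaseChangeEquiv (proPure f a) (toAdicBaseChange A' (b ⊗ₜ x)) =
      a * b * algebraMap A A' (f x) :=
  (hU.exists_dualBaseChangeEquiv A').choose_spec f a b x

theorem dualBaseChangeEquiv_naturality {V : Type v} [AddCommGroup V] [Module A V]
    (hU : IsOrthonormalizable A U) (hV : IsOrthonormalizable A V) (φ : U →ₗ[A] V)
    (y : proBaseChange A A' (PointwiseDual A V)) :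
    hU.dualBaseChangeEquiv (proBaseChangeMap A' (PointwiseDual.map φ) y) =
      PointwiseDual.map (U := adicBaseChange A A' U) (U' := adicBaseChange A A' V)
        (adicBaseChangeMap A' φ) (hV.dualBaseChangeEquiv y) := by
  let F : proBaseChange A A' (PointwiseDual A U) →L[A'] PointwiseDual A' (adicBaseChange A A' U) :=
    hU.dualBaseChangeEquiv (A' := A')
  let F' : proBaseChange A A' (PointwiseDual A V) →L[A'] PointwiseDual A' (adicBaseChange A A' V) :=
    hV.dualBaseChangeEquiv (A' := A')
  have : T2Space (PointwiseDual A' (adicBaseChange A A' U)) :=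
    PointwiseDual.isProfiniteModule.t2Space
  suffices h : F ∘L proBaseChangeMap A' (PointwiseDual.map φ) =
      PointwiseDual.map (U := adicBaseChange A A' U) (U' := adicBaseChange A A' V)
        (adicBaseChangeMap A' φ) ∘L F' from DFunLike.congr_fun h y
  refine proBaseChange_hom_ext fun f a => hU.adicBaseChange_hom_ext fun x => ?_
  refine (hU.dualBaseChangeEquiv_proPure (PointwiseDual.map φ f) a 1 x).trans ?_
  refine (hV.dualBaseChangeEquiv_proPure f a 1 (φ x)).symm.trans ?_
  rw [← LinearMap.baseChange_tmul, ← adicBaseChangeMap_toAdicBaseChange]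
  rfl

end IsOrthonormalizable

variable (A A') in
/-- The natural isomorphism `Hom_A(π, A) ⊗̂ A' ≅ Hom_{A'}(π ⊗̂ A', A')`. -/
def dualBaseChangeNatIso (G : Type w) [Group G] [TopologicalSpace G] :
    ((contFl.{u} A G).ι.op ⋙ dualFunctor A G ⋙ proBaseChangeFunctor A' G) ≅
      ((contFl.{u} A G).ι.op ⋙ (adicBaseChangeFunctor A' G).op ⋙ dualFunctor A' G) :=
  NatIso.ofComponents
    (fun X => topRepIsoOfEquiv X.unop.property.2.dualBaseChangeEquiv fun g m =>
      X.unop.property.2.dualBaseChangeEquiv_naturality X.unop.property.2 (X.unop.obj.ρ g⁻¹) m)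
    fun {X Y} f => TopRep.hom_ext <| ContIntertwiningMap.ext <| ContinuousLinearMap.ext fun y =>
      Y.unop.property.2.dualBaseChangeEquiv_naturality X.unop.property.2
        f.unop.hom.hom.toLinearMap y

end DualBaseChange

section ProAugBaseChange

section Iso

variable {A : Type u} [CommRing A] [TopologicalSpace A] {G : Type w} [Group G] [TopologicalSpace G]
  {M N : TopRep.{v} A G}

theorem IsAugmented.of_equiv (hM : IsAugmented M) (e : M ≃L[A] N)
    (he : ∀ g m, e (M.ρ g m) = N.ρ g (e m)) : IsAugmented N := by
  obtain ⟨K, hKo, hKc, _, hcompat, hcont⟩ := hM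
  let _ : SMul (CompletedGroupAlgebra A K) N := ⟨fun r n => e (r • e.symm n)⟩
  let _ : Module (CompletedGroupAlgebra A K) N :=
    e.symm.injective.module (CompletedGroupAlgebra A K) (e.symm : N ≃+ M).toAddMonoidHom
      fun r n => e.symm_apply_apply _
  refine ⟨K, hKo, hKc, inferInstance, fun x n => (congrArg e (hcompat x (e.symm n))).trans ?_,
    e.continuous.comp (hcont.comp (continuous_fst.prodMk (e.symm.continuous.comp continuous_snd)))⟩
  induction x using MonoidAlgebra.induction_linear with
  | zero => simp
  | add x y hx hy => simp only [map_add, LinearMap.add_apply, hx, hy]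
  | single k a =>
    simp only [Representation.asAlgebraHom_single, LinearMap.smul_apply]
    refine (map_smul e a _).trans (congrArg (a • ·) ((he k _).trans ?_))
    exact congrArg (N.ρ k) (e.apply_symm_apply n)

theorem proAugFl_of_equiv (hM : proAugFl A G M) (e : M ≃L[A] N)
    (he : ∀ g m, e (M.ρ g m) = N.ρ g (e m)) : proAugFl A G N :=
  ⟨⟨hM.1.1.of_equiv e, hM.1.2.of_equiv e he⟩, hM.2.imp fun _ ⟨μ⟩ => ⟨e.symm.trans μ⟩⟩

theorem proAugFl_of_iso (i : M ≅ N) (hM : proAugFl A G M) : proAugFl A G N :=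
  proAugFl_of_equiv hM
    (.equivOfInverse i.hom.hom.toContinuousLinearMap i.inv.hom.toContinuousLinearMap
      (fun x => congrArg (fun f : M ⟶ M => f.hom x) i.hom_inv_id)
      fun x => congrArg (fun f : N ⟶ N => f.hom x) i.inv_hom_id)
    fun g m => TopRep.hom_comm_apply i.hom g m

end Iso

theorem proAugFl_proBaseChange {A : Type u} [CommRing A] [TopologicalSpace A]
    [IsCompleteNoetherianLocal A] {A' : Type u} [CommRing A'] [TopologicalSpace A']
    [IsCompleteNoetherianLocal A'] [Algebra A A'] [IsLocalHom (algebraMap A A')] {G : Type w}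
    [Group G] [TopologicalSpace G] [IsTopologicalGroup G] [T2Space G] [LocallyCompactSpace G]
    [TotallyDisconnectedSpace G] {M : TopRep.{u} A G} (hM : proAugFl A G M) :
    proAugFl A' G ((proBaseChangeFunctor A' G).obj M) := by
  have hdual := contFl_contDual hM
  have := isIso_evalTopRep hM.1.1 hM.2
  let i : (proBaseChangeFunctor A' G).obj M ≅ _ :=
    (proBaseChangeFunctor A' G).mapIso (asIso (evalTopRep A G M)) ≪≫
      (dualBaseChangeNatIso A A' G).app (.op ⟨_, hdual⟩)
  exact proAugFl_of_iso i.symm (proAugFl_dual (contFl_adicBaseChange hdual))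

end ProAugBaseChange

end

/-- Duality between orthonormalizable `𝔪`-adically continuous `A[G]`-modules and topologically free
profinite augmented `G`-representations over `A`, and its compatibility with base change. The
functors `π ↦ Hom_A(π, A)` and `M ↦ Hom_A^cont(M, A)` restrict to the two categories, both
restrictions are equivalences, and they are mutually quasi-inverse through the evaluation maps.
Base change along a local homomorphism `A → A'` preserves both categories, and there is a natural
isomorphism `Hom_A(π, A) ⊗̂_A A' ≅ Hom_{A'}(π ⊗̂_A A', A')` of topological representations, which
sends `f ⊗ a` to the linear form with `x ⊗ b ↦ a b f(x)`. -/
theorem mainTheorem9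
    (G : Type w) [Group G] [TopologicalSpace G] [IsTopologicalGroup G] [T2Space G]
    [LocallyCompactSpace G] [TotallyDisconnectedSpace G]
    (A : Type u) [CommRing A] [TopologicalSpace A] [IsCompleteNoetherianLocal A] :
    (∃ (hD : ∀ π : Rep.{u} A G, contFl A G π → proAugFl A G ((dualFunctor A G).obj (.op π)))
      (hE : ∀ M : TopRep.{u} A G, proAugFl A G M →
        contFl A G ((contDualFunctor A G).obj (.op M))),
      (dualFl A G hD).IsEquivalence ∧ (contDualFl A G hE).IsEquivalence ∧
      (∀ π : Rep.{u} A G, contFl A G π → IsIso (evalRep A G π)) ∧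
      (∀ M : TopRep.{u} A G, proAugFl A G M → IsIso (evalTopRep A G M))) ∧
    (∀ (A' : Type u) [CommRing A'] [TopologicalSpace A'] [IsCompleteNoetherianLocal A']
      [Algebra A A'] [IsLocalHom (algebraMap A A')],
      (∀ π : Rep.{u} A G, contFl A G π → contFl A' G ((adicBaseChangeFunctor A' G).obj π)) ∧
      (∀ M : TopRep.{u} A G, proAugFl A G M → proAugFl A' G ((proBaseChangeFunctor A' G).obj M)) ∧
      ∃ Φ : ((contFl.{u} A G).ι.op ⋙ dualFunctor A G ⋙ proBaseChangeFunctor A' G) ≅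
          ((contFl.{u} A G).ι.op ⋙ (adicBaseChangeFunctor A' G).op ⋙ dualFunctor A' G),
        ∀ (X : (contFl.{u} A G).FullSubcategory) (f : (dualFunctor A G).obj (.op X.obj))
          (a b : A') (x : X.obj),
          dualApply ((adicBaseChangeFunctor A' G).obj X.obj)
            ((Φ.hom.app (.op X)).hom (proTmul A' ((dualFunctor A G).obj (.op X.obj)) f a))
            (adicTmul A' X.obj x b) = a * b * algebraMap A A' (dualApply X.obj f x)) := by
  refine ⟨⟨fun _ => proAugFl_dual, fun _ => contFl_contDual, isEquivalence_dualFl A G,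
    isEquivalence_contDualFl A G, fun _ hπ => isIso_evalRep hπ.2,
    fun _ hM => isIso_evalTopRep hM.1.1 hM.2⟩, fun A' _ _ _ _ _ => ⟨fun _ => contFl_adicBaseChange,
    fun _ => proAugFl_proBaseChange, dualBaseChangeNatIso A A' G, fun X f a b x => ?_⟩⟩
  have hformula := X.property.2.dualBaseChangeEquiv_proPure f a b x
  rwa [toAdicBaseChange_tmul] at hformula
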